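/- Let $\mathbb K=\mathbb R$ or $\mathbb C$ and let $X,Y$ be Banach spaces over $\mathbb K$ such that the dual $X'$ is separable and has the approximation property. Let $k\ge 0$ be an integer, and let $\mathcal P_k(X;Y')$ be the space of continuous polynomials $P=\sum_{j=0}^k P_j$ of degree at most $k$ from $X$ to $Y'$, where $P_j(x)=\Phi_j(x,\dots,x)$ for a (unique) symmetric continuous $j$-linear map $\Phi_j\colon X^j\to Y'$, endowed with the norm $\|P\|=\sup_{\|x\|\le 1}\|P(x)\|$. The Aron–Berner extension of $P$ is the polynomial $\overline P=\sum_{j=0}^k\overline{P_j}\in\mathcal P_k(X'';Y''')$, $\overline{P_j}(x'')=\overline{\Phi_j}(x'',\dots,x'')$, where $$\overline{\Phi_j}(x_1'',\dots,x_j'')=w^*\text{-}\lim_{\alpha_1}\cdots\lim_{\alpha_j}\Phi_j(x_{1,\alpha_1},\dots,x_{j,\alpha_j})$$ for nets $(x_{i,\alpha_i})_{\alpha_i}$ in $X$ converging weak-star to $x_i''$. One says that $\overline P$ attains its norm if there is $x_0''\in X''$ with $\|x_0''\|\le 1$ and $\|\overline P(x_0'')\|=\|\overline P\|=\sup_{\|x''\|\le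 1}\|\overline P(x'')\|$. Then the set of all $P\in\mathcal P_k(X;Y')$ whose Aron–Berner extension attains its norm is norm dense in $\mathcal P_k(X;Y')$. -/

import Mathlib

set_option maxSynthPendingDepth 3

open Set Metric Topology Filter

noncomputable section

/-- A normed space `E` has the approximation property: on every compact set the identity is a
uniform limit of continuous linear operators of finite rank. -/
def HasApproximationProperty (𝕜 E : Type*) [RCLike 𝕜] [NormedAddCommGroup E]
    [NormedSpace 𝕜 E] : Prop :=
  ∀ K : Set E, IsCompact K → ∀ ε : ℝ, 0 < ε →
    ∃ T : E →L[𝕜] E, FiniteDimensional 𝕜 (T : E →ₗ[𝕜] E).range ∧ ∀ x ∈ K, ‖T x - x‖ ≤ ε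

/-! ### Canonical (Arens) extension of continuous multilinear maps to the bidual -/

section Arens

variable {𝕜 X W : Type*} [RCLike 𝕜] [NormedAddCommGroup X] [NormedSpace 𝕜 X]
  [NormedAddCommGroup W] [NormedSpace 𝕜 W]

/-- The canonical extension to `X''` of a continuous `N`-linear form on `X`, depending linearly and
continuously on the form. It is determined by `arensForm_zero` and `arensForm_succ`: the value at
`(z₁, …, z_N)` is `z₁ (x₁ ↦ z₂ (x₂ ↦ ⋯ z_N (x_N ↦ φ (x₁, …, x_N)) ⋯ ))`, i.e. the iterated limit
`lim_{α₁} ⋯ lim_{α_N} φ (x_{1,α₁}, …, x_{N,α_N})` along nets that converge weak-star to the `z_i`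
(see `arensForm_tendsto`). -/
def arensForm (𝕜 X : Type*) [RCLike 𝕜] [NormedAddCommGroup X] [NormedSpace 𝕜 X] :
    (N : ℕ) → (X [×N]→L[𝕜] 𝕜) →L[𝕜] (StrongDual 𝕜 (StrongDual 𝕜 X) [×N]→L[𝕜] 𝕜)
  | 0 =>
    ((continuousMultilinearCurryFin0 𝕜 (StrongDual 𝕜 (StrongDual 𝕜 X)) 𝕜).symm :
        𝕜 →L[𝕜] (StrongDual 𝕜 (StrongDual 𝕜 X) [×0]→L[𝕜] 𝕜)) ∘L
      ((continuousMultilinearCurryFin0 𝕜 X 𝕜) : (X [×0]→L[𝕜] 𝕜) →L[𝕜] 𝕜)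
  | N + 1 =>
    ((continuousMultilinearCurryLeftEquiv 𝕜
        (fun _ : Fin (N + 1) => StrongDual 𝕜 (StrongDual 𝕜 X)) 𝕜).symm :
          (StrongDual 𝕜 (StrongDual 𝕜 X) →L[𝕜] (StrongDual 𝕜 (StrongDual 𝕜 X) [×N]→L[𝕜] 𝕜))
            →L[𝕜] (StrongDual 𝕜 (StrongDual 𝕜 X) [×(N + 1)]→L[𝕜] 𝕜)) ∘L
      (ContinuousLinearMap.compContinuousMultilinearMapL 𝕜
        (fun _ : Fin N => StrongDual 𝕜 (StrongDual 𝕜 X)) (X →L[𝕜] 𝕜) 𝕜).flip ∘L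
      ((ContinuousLinearMap.flipMultilinearEquiv 𝕜
        (fun _ : Fin N => StrongDual 𝕜 (StrongDual 𝕜 X)) X 𝕜) :
          (X →L[𝕜] (StrongDual 𝕜 (StrongDual 𝕜 X) [×N]→L[𝕜] 𝕜)) →L[𝕜]
            (StrongDual 𝕜 (StrongDual 𝕜 X) [×N]→L[𝕜] (X →L[𝕜] 𝕜))) ∘L
      (ContinuousLinearMap.compL 𝕜 X (X [×N]→L[𝕜] 𝕜)
        (StrongDual 𝕜 (StrongDual 𝕜 X) [×N]→L[𝕜] 𝕜) (arensForm 𝕜 X N)) ∘L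
      ((continuousMultilinearCurryLeftEquiv 𝕜 (fun _ : Fin (N + 1) => X) 𝕜) :
        (X [×(N + 1)]→L[𝕜] 𝕜) →L[𝕜] (X →L[𝕜] (X [×N]→L[𝕜] 𝕜)))

theorem arensForm_zero (φ : X [×0]→L[𝕜] 𝕜) (z : Fin 0 → StrongDual 𝕜 (StrongDual 𝕜 X)) :
    arensForm 𝕜 X 0 φ z = φ 0 := rfl

/-- `x₁ ↦ φ̄ (x₁, z₂, …, z_{N+1})`, as a continuous linear form on `X`. -/
def arensSlice {N : ℕ} (φ : X [×(N + 1)]→L[𝕜] 𝕜)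
    (z : Fin N → StrongDual 𝕜 (StrongDual 𝕜 X)) : StrongDual 𝕜 X :=
  (arensForm 𝕜 X N ∘L φ.curryLeft).flipMultilinear z

theorem arensSlice_apply {N : ℕ} (φ : X [×(N + 1)]→L[𝕜] 𝕜)
    (z : Fin N → StrongDual 𝕜 (StrongDual 𝕜 X)) (x : X) :
    arensSlice φ z x = arensForm 𝕜 X N (φ.curryLeft x) z := rfl

theorem arensForm_succ {N : ℕ} (φ : X [×(N + 1)]→L[𝕜] 𝕜)
    (z : Fin (N + 1) → StrongDual 𝕜 (StrongDual 𝕜 X)) :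
    arensForm 𝕜 X (N + 1) φ z = z 0 (arensSlice φ (Fin.tail z)) := rfl

theorem arensForm_tendsto {ι : Type*} {l : Filter ι} {N : ℕ} (φ : X [×(N + 1)]→L[𝕜] 𝕜)
    (z : Fin (N + 1) → StrongDual 𝕜 (StrongDual 𝕜 X)) (x : ι → X)
    (hx : ∀ f : StrongDual 𝕜 X, Tendsto (fun α => f (x α)) l (𝓝 (z 0 f))) :
    Tendsto (fun α => arensForm 𝕜 X N (φ.curryLeft (x α)) (Fin.tail z)) l
      (𝓝 (arensForm 𝕜 X (N + 1) φ z)) :=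
  hx (arensSlice φ (Fin.tail z))

/-- The canonical (Arens) extension `Φ̄ : X'' × ⋯ × X'' → W''` of a continuous multilinear map
`Φ : X × ⋯ × X → W`; the limits are taken for the weak-star topology of `W''`, that is,
`Φ̄ (z) (w') = (w' ∘ Φ)¯ (z)` for `w' ∈ W'`. -/
def arens {N : ℕ} (Φ : X [×N]→L[𝕜] W) :
    StrongDual 𝕜 (StrongDual 𝕜 X) [×N]→L[𝕜] StrongDual 𝕜 (StrongDual 𝕜 W) :=
  (arensForm 𝕜 X N ∘L
    (ContinuousLinearMap.compContinuousMultilinearMapL 𝕜 (fun _ : Fin N => X) W 𝕜).flip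
      Φ).flipMultilinear

theorem arens_apply {N : ℕ} (Φ : X [×N]→L[𝕜] W)
    (z : Fin N → StrongDual 𝕜 (StrongDual 𝕜 X)) (w' : StrongDual 𝕜 W) :
    arens Φ z w' = arensForm 𝕜 X N (w'.compContinuousMultilinearMap Φ) z := rfl

end Arens

/-! ### Continuous polynomials of degree at most `k` -/

section Poly

variable {𝕜 : Type*} {k : ℕ} {X W : Type*} [RCLike 𝕜] [NormedAddCommGroup X] [NormedSpace 𝕜 X]
  [NormedAddCommGroup W] [NormedSpace 𝕜 W]

/-- The linear space of all functions `P = P₀ + ⋯ + P_k` with `P_j (x) = Φ_j (x, …, x)` for some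
continuous `j`-linear maps `Φ_j`. -/
def polySubmodule (𝕜 : Type*) (k : ℕ) (X W : Type*) [RCLike 𝕜] [NormedAddCommGroup X]
    [NormedSpace 𝕜 X] [NormedAddCommGroup W] [NormedSpace 𝕜 W] : Submodule 𝕜 (X → W) where
  carrier := {P | ∃ Φ : (j : ℕ) → X [×j]→L[𝕜] W,
    ∀ x, P x = ∑ j ∈ Finset.range (k + 1), Φ j (fun _ => x)}
  add_mem' := by
    rintro P Q ⟨Φ, hΦ⟩ ⟨Ψ, hΨ⟩
    exact ⟨fun j => Φ j + Ψ j, fun x => by simp [hΦ, hΨ, Finset.sum_add_distrib]⟩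
  zero_mem' := ⟨fun _ => 0, fun x => by simp⟩
  smul_mem' := by
    rintro c P ⟨Φ, hΦ⟩
    exact ⟨fun j => c • Φ j, fun x => by simp [hΦ, Finset.smul_sum]⟩

/-- `ContPoly 𝕜 k X W` is the space of continuous polynomials of degree at most `k` from `X`
to `W`. -/
def ContPoly (𝕜 : Type*) (k : ℕ) (X W : Type*) [RCLike 𝕜] [NormedAddCommGroup X]
    [NormedSpace 𝕜 X] [NormedAddCommGroup W] [NormedSpace 𝕜 W] : Type _ :=
  ↥(polySubmodule 𝕜 k X W)

namespace ContPoly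

instance : AddCommGroup (ContPoly 𝕜 k X W) :=
  inferInstanceAs (AddCommGroup ↥(polySubmodule 𝕜 k X W))

instance : Module 𝕜 (ContPoly 𝕜 k X W) :=
  inferInstanceAs (Module 𝕜 ↥(polySubmodule 𝕜 k X W))

instance : CoeFun (ContPoly 𝕜 k X W) (fun _ => X → W) := ⟨fun P => P.1⟩

theorem ext_fun {P Q : ContPoly 𝕜 k X W} (h : ∀ x, P x = Q x) : P = Q :=
  Subtype.ext (funext h)

/-- The supremum norm on the closed unit ball of `X`. -/
instance : Norm (ContPoly 𝕜 k X W) := ⟨fun P => ⨆ x : closedBall (0 : X) 1, ‖P x‖⟩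

theorem norm_def (P : ContPoly 𝕜 k X W) : ‖P‖ = ⨆ x : closedBall (0 : X) 1, ‖P x‖ := rfl

theorem bddAbove (P : ContPoly 𝕜 k X W) :
    BddAbove (range fun x : closedBall (0 : X) 1 => ‖P x‖) := by
  obtain ⟨Φ, hΦ⟩ := P.2
  refine ⟨∑ j ∈ Finset.range (k + 1), ‖Φ j‖, ?_⟩
  rintro _ ⟨⟨x, hx⟩, rfl⟩
  have hx1 : ‖x‖ ≤ 1 := by simpa using hx
  simp only [hΦ x]
  refine (norm_sum_le _ _).trans (Finset.sum_le_sum fun j _ => ?_)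
  refine ((Φ j).le_opNorm _).trans ?_
  simpa using mul_le_mul_of_nonneg_left (pow_le_one₀ (n := j) (norm_nonneg x) hx1)
    (norm_nonneg (Φ j))

theorem norm_apply_le (P : ContPoly 𝕜 k X W) {x : X} (hx : ‖x‖ ≤ 1) : ‖P x‖ ≤ ‖P‖ :=
  le_ciSup P.bddAbove (⟨x, by simpa using hx⟩ : closedBall (0 : X) 1)

/-- `Φ` lists the symmetric multilinear maps of the homogeneous parts of `P`. -/
def IsSymmRep (P : ContPoly 𝕜 k X W) (Φ : (j : ℕ) → X [×j]→L[𝕜] W) : Prop :=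
  (∀ (j : ℕ) (σ : Equiv.Perm (Fin j)) (v : Fin j → X), Φ j (v ∘ σ) = Φ j v) ∧
    ∀ x, P x = ∑ j ∈ Finset.range (k + 1), Φ j (fun _ => x)

theorem diag_eq_zero {Φ : (j : ℕ) → X [×j]→L[𝕜] W}
    (h : ∀ x : X, ‖x‖ ≤ 1 → ∑ j ∈ Finset.range (k + 1), Φ j (fun _ => x) = 0)
    {j : ℕ} (hj : j ≤ k) (x : X) : Φ j (fun _ => x) = 0 := by
  set p : FormalMultilinearSeries 𝕜 X W := fun j => if j ≤ k then Φ j else 0 with hp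
  have hp0 : ∀ n, n ∉ Finset.range (k + 1) → p n = 0 := by
    intro n hn
    have : ¬ n ≤ k := by simpa [Nat.lt_succ_iff] using hn
    simp [hp, this]
  have hs : HasFPowerSeriesAt (0 : X → W) p 0 := by
    refine ⟨1, ⟨?_, one_pos, ?_⟩⟩
    · rw [FormalMultilinearSeries.radius_eq_top_of_forall_image_add_eq_zero p (k + 1)
        (fun m => hp0 _ (by simp; omega))]
      exact le_top
    · intro y hy
      have hy1 : ‖y‖ ≤ 1 := by
        have : (‖y‖ₑ) < 1 := by simpa using hy
        rw [← ofReal_norm, ENNReal.ofReal_lt_one] at this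
        exact this.le
      have := hasSum_sum_of_ne_finset_zero (s := Finset.range (k + 1))
        (f := fun n => p n fun _ => y) (L := .unconditional ℕ)
        (fun n hn => by simp [hp0 n hn])
      have h1 : ∑ n ∈ Finset.range (k + 1), (p n fun _ => y) = 0 := by
        rw [← h y hy1]
        refine Finset.sum_congr rfl fun n hn => ?_
        have : n ≤ k := by simpa [Nat.lt_succ_iff] using hn
        simp [hp, this]
      rw [h1] at this
      exact this
  have := hs.apply_eq_zero j x
  simpa [hp, hj] using this

theorem symm_eq_zero {j : ℕ} {Φ : X [×j]→L[𝕜] W}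
    (hs : ∀ (σ : Equiv.Perm (Fin j)) (v : Fin j → X), Φ (v ∘ σ) = Φ v)
    (h : ∀ x : X, Φ (fun _ => x) = 0) : Φ = 0 := by
  ext v
  have h1 := Φ.iteratedFDeriv_comp_diagonal (0 : X) v
  have h2 : (fun x : X => Φ fun _ => x) = fun _ => 0 := funext h
  rw [h2] at h1
  have h3 : ∀ σ : Equiv.Perm (Fin j), Φ (fun i => v (σ i)) = Φ v := fun σ => hs σ v
  simp only [h3, Finset.sum_const, Finset.card_univ] at h1
  have h4 : Fintype.card (Equiv.Perm (Fin j)) • Φ v = 0 := by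
    rw [← h1]
    simp [iteratedFDeriv_fun_zero]
  rw [← Nat.cast_smul_eq_nsmul 𝕜, smul_eq_zero] at h4
  rcases h4 with h4 | h4
  · exact absurd (Nat.cast_eq_zero.mp h4) Fintype.card_ne_zero
  · simpa using h4

theorem IsSymmRep.unique {P : ContPoly 𝕜 k X W} {Φ Ψ : (j : ℕ) → X [×j]→L[𝕜] W}
    (hΦ : P.IsSymmRep Φ) (hΨ : P.IsSymmRep Ψ) {j : ℕ} (hj : j ≤ k) : Φ j = Ψ j := by
  rw [← sub_eq_zero]
  refine symm_eq_zero (fun σ v => by simp [hΦ.1 j σ v, hΨ.1 j σ v]) fun x => ?_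
  refine diag_eq_zero (k := k) (Φ := fun j => Φ j - Ψ j) (fun x _ => ?_) hj x
  simp [Finset.sum_sub_distrib, ← hΦ.2 x, ← hΨ.2 x]

theorem exists_isSymmRep (P : ContPoly 𝕜 k X W) :
    ∃ Φ : (j : ℕ) → X [×j]→L[𝕜] W, P.IsSymmRep Φ := by
  obtain ⟨Φ, hΦ⟩ := P.2
  refine ⟨fun j => ((Nat.factorial j : 𝕜)⁻¹) •
    ∑ τ : Equiv.Perm (Fin j), (Φ j).domDomCongr τ, fun j σ v => ?_, fun x => ?_⟩
  · simp only [smul_apply, sum_apply,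
      ContinuousMultilinearMap.domDomCongr_apply, Function.comp_apply]
    congr 1
    exact Fintype.sum_equiv (Equiv.mulLeft σ) _ _ fun τ => by simp
  · rw [hΦ x]
    refine Finset.sum_congr rfl fun j _ => ?_
    have hj : (Nat.factorial j : 𝕜) ≠ 0 := Nat.cast_ne_zero.mpr (Nat.factorial_ne_zero j)
    simp only [smul_apply, sum_apply,
      ContinuousMultilinearMap.domDomCongr_apply, Finset.sum_const, Finset.card_univ,
      Fintype.card_perm, Fintype.card_fin]
    rw [← Nat.cast_smul_eq_nsmul 𝕜, smul_smul, inv_mul_cancel₀ hj, one_smul]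

theorem core : NormedSpace.Core 𝕜 (ContPoly 𝕜 k X W) where
  norm_nonneg P := Real.iSup_nonneg fun _ => norm_nonneg _
  norm_smul c P := by
    have : ∀ x : X, (c • P) x = c • P x := fun _ => rfl
    simp only [norm_def, this, norm_smul]
    exact (Real.mul_iSup_of_nonneg (norm_nonneg c) _).symm
  norm_triangle P Q := by
    have : Nonempty (closedBall (0 : X) 1) := ⟨⟨0, by simp⟩⟩
    refine ciSup_le fun x => (norm_add_le (P x) (Q x)).trans ?_
    have hx : ‖(x : X)‖ ≤ 1 := mem_closedBall_zero_iff.mp x.2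
    exact add_le_add (P.norm_apply_le hx) (Q.norm_apply_le hx)
  norm_eq_zero_iff P := by
    constructor
    · intro h
      obtain ⟨Φ, hΦ⟩ := P.2
      have h0 : ∀ x : X, ‖x‖ ≤ 1 → ∑ j ∈ Finset.range (k + 1), Φ j (fun _ => x) = 0 := by
        intro x hx
        rw [← hΦ x]
        exact norm_le_zero_iff.mp (h ▸ P.norm_apply_le hx)
      refine ext_fun fun x => ?_
      rw [hΦ x]
      exact Finset.sum_eq_zero fun j hj =>
        diag_eq_zero h0 (Nat.lt_succ_iff.mp (Finset.mem_range.mp hj)) x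
    · rintro rfl
      have : ∀ x : X, (0 : ContPoly 𝕜 k X W) x = 0 := fun _ => rfl
      simp [norm_def, this]

instance : NormedAddCommGroup (ContPoly 𝕜 k X W) := NormedAddCommGroup.ofCore core

instance : NormedSpace 𝕜 (ContPoly 𝕜 k X W) := NormedSpace.ofCore core

/-- `P` attains its norm at a point of the closed unit ball. -/
def NormAttaining (P : ContPoly 𝕜 k X W) : Prop := ∃ x₀ : X, ‖x₀‖ ≤ 1 ∧ ‖P x₀‖ = ‖P‖

/-- The unique symmetric `j`-linear map associated with the `j`-homogeneous part of `P`
(for `j ≤ k`). -/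
def symmPart (P : ContPoly 𝕜 k X W) : (j : ℕ) → X [×j]→L[𝕜] W := P.exists_isSymmRep.choose

theorem symmPart_spec (P : ContPoly 𝕜 k X W) : P.IsSymmRep P.symmPart :=
  P.exists_isSymmRep.choose_spec

/-- The Aron–Berner extension `P̄ = P̄₀ + ⋯ + P̄_k`, where `P̄_j (z) = Φ̄_j (z, …, z)` and `Φ̄_j` is the
canonical extension of the symmetric `j`-linear map `Φ_j` of the `j`-homogeneous part `P_j`. -/
def aronBerner (P : ContPoly 𝕜 k X W) :
    ContPoly 𝕜 k (StrongDual 𝕜 (StrongDual 𝕜 X)) (StrongDual 𝕜 (StrongDual 𝕜 W)) :=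
  ⟨fun z => ∑ j ∈ Finset.range (k + 1), arens (P.symmPart j) (fun _ => z),
    fun j => arens (P.symmPart j), fun _ => rfl⟩

theorem aronBerner_apply (P : ContPoly 𝕜 k X W) {Φ : (j : ℕ) → X [×j]→L[𝕜] W}
    (hΦ : P.IsSymmRep Φ) (z : StrongDual 𝕜 (StrongDual 𝕜 X)) :
    P.aronBerner z = ∑ j ∈ Finset.range (k + 1), arens (Φ j) (fun _ => z) := by
  change ∑ j ∈ Finset.range (k + 1), arens (P.symmPart j) (fun _ => z) = _
  exact Finset.sum_congr rfl fun j hj => by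
    rw [P.symmPart_spec.unique hΦ (Nat.lt_succ_iff.mp (Finset.mem_range.mp hj))]

end ContPoly

end Poly

end

/-!
The spaces `ContPoly 𝕜 k X Y'` are quotients of a dual space: the tuples of continuous `j`-linear
maps `X × ⋯ × X → Y'`, `j ≤ k`, form the dual of the product of the projective tensor products
`X ⊗ ⋯ ⊗ X ⊗ Y` (`TensorPredual`), and the evaluations `Q ↦ Q x y` become points `polyTensor x y` of
this predual. Let `C` be the closed convex hull of the evaluations at points of the unit balls; the
supremum of (the real part of) the functional given by `Q` over `C` is `‖Q‖`. By the Bishop–Phelps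
theorem for `C` (`exists_dual_norm_sub_le_forall_re_le`), every `P` is approximated by some `Q` for
which this supremum is attained at a point `u ∈ C`.

The point `u` has an integral representation. Since `u` is a limit of convex combinations of
evaluations, weak-star compactness yields a probability measure `μ` on `B_{X''} × B_{Y''}` with
`⟨Φ, u⟩ = ∫ Φ̄(z, …, z)(w) dμ(z, w)` for the `Φ` of finite type, whose extension is weak-star
continuous. The approximation property extends the formula to all `Φ`
(`TensorPredual.pairing_eq_integral_arens`): as `u` is also an absolutely convergent series of
elementary tensors, both sides are integrals over finite measures, and two such integrals that agree
on products of functionals agree on all multilinear maps (`integral_arens_eq_zero`). That is proved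
one variable at a time, the first variable being outermost in the canonical extension: separability
of `X'` makes the slice `G` of the extension a strongly measurable `X'`-valued function, and for a
functional `T ↦ ∫ z(T G)` on the operators of `X'` the approximation property carries vanishing
from the rank one operators `g ↦ g x • f` to the identity
(`HasApproximationProperty.integral_apply_eq_zero`).

Consequently `‖Q‖ ≤ re ⟨Q, u⟩ = ∫ re Q̄(z)(w) dμ`, so `‖Q‖ ≤ ‖Q̄(z)‖` for some `z` in the unit ball
of `X''`. Since `‖Q̄‖ ≤ ‖Q‖` by the theorem of Davie and Gamelin (`ContPoly.norm_aronBerner_le`),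
`Q̄` attains its norm at `z`.
-/

open MeasureTheory ENNReal

/-! ### Scalarly measurable maps into a dual space and its dual -/

section Measurability

variable {𝕜 X Ω : Type*} [RCLike 𝕜] [NormedAddCommGroup X] [NormedSpace 𝕜 X] [MeasurableSpace Ω]

/-- A separable dual is normed by a sequence in the unit ball of the predual. -/
theorem exists_norming_seq (hsep : TopologicalSpace.SeparableSpace (StrongDual 𝕜 X)) :
    ∃ x : ℕ × ℕ → X, (∀ n, ‖x n‖ ≤ 1) ∧
      ∀ (g : StrongDual 𝕜 X) (r : ℝ), (∀ n, ‖g (x n)‖ ≤ r) → ‖g‖ ≤ r := by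
  have key : ∀ p : ℕ × ℕ, ∃ x : X, ‖x‖ ≤ 1 ∧
      ‖TopologicalSpace.denseSeq (StrongDual 𝕜 X) p.1‖ - 1 / ((p.2 : ℝ) + 1) <
        ‖TopologicalSpace.denseSeq (StrongDual 𝕜 X) p.1 x‖ := by
    intro p
    have hpos : (0 : ℝ) < 1 / ((p.2 : ℝ) + 1) := by positivity
    obtain ⟨x, hx, hx'⟩ := ContinuousLinearMap.exists_lt_apply_of_lt_opNorm
      (TopologicalSpace.denseSeq (StrongDual 𝕜 X) p.1)
      (r := ‖TopologicalSpace.denseSeq (StrongDual 𝕜 X) p.1‖ - 1 / ((p.2 : ℝ) + 1))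
      (by linarith)
    exact ⟨x, hx.le, hx'⟩
  choose x hx hx' using key
  refine ⟨x, hx, fun g r hr => le_of_forall_pos_le_add fun ε hε => ?_⟩
  obtain ⟨k, hk⟩ := exists_nat_one_div_lt (show (0 : ℝ) < ε / 3 by positivity)
  obtain ⟨n, hn⟩ := (TopologicalSpace.denseRange_denseSeq (StrongDual 𝕜 X)).exists_dist_lt g
    (show (0 : ℝ) < ε / 3 by positivity)
  rw [dist_eq_norm] at hn
  set f := TopologicalSpace.denseSeq (StrongDual 𝕜 X) n with hf
  have h1 := hx' (n, k)
  simp only [← hf] at h1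
  have h2 : ‖f (x (n, k))‖ ≤ ‖g (x (n, k))‖ + ‖g - f‖ := by
    have h3 : ‖(g - f) (x (n, k))‖ ≤ ‖g - f‖ := (g - f).unit_le_opNorm _ (hx _)
    have h4 : f (x (n, k)) = g (x (n, k)) - (g - f) (x (n, k)) := by simp
    rw [h4]
    exact (norm_sub_le _ _).trans (by linarith)
  have h5 : ‖g‖ ≤ ‖f‖ + ‖g - f‖ := by
    have := norm_add_le f (g - f)
    rwa [add_sub_cancel] at this
  have := hr (n, k)
  linarith

theorem stronglyMeasurable_of_forall_apply
    (hsep : TopologicalSpace.SeparableSpace (StrongDual 𝕜 X)) {G : Ω → StrongDual 𝕜 X}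
    (hG : ∀ x, Measurable fun ω => G ω x) : StronglyMeasurable G := by
  borelize (StrongDual 𝕜 X)
  have : SecondCountableTopology (StrongDual 𝕜 X) :=
    UniformSpace.secondCountable_of_separable _
  refine Measurable.stronglyMeasurable ?_
  obtain ⟨x, hx, hx'⟩ := exists_norming_seq hsep
  have hball : ∀ (f : StrongDual 𝕜 X) (r : ℝ), MeasurableSet {ω | ‖G ω - f‖ ≤ r} := by
    intro f r
    have : {ω | ‖G ω - f‖ ≤ r} = ⋂ n, {ω | ‖G ω (x n) - f (x n)‖ ≤ r} := by
      ext ω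
      simp only [mem_ofPred_eq, mem_iInter]
      exact ⟨fun h n => ((G ω - f).unit_le_opNorm _ (hx n)).trans h, fun h => hx' _ _ h⟩
    rw [this]
    exact MeasurableSet.iInter fun n =>
      measurableSet_le ((hG (x n)).sub_const _).norm measurable_const
  refine measurable_of_isOpen fun U hU => ?_
  have hU' : G ⁻¹' U = ⋃ (n : ℕ) (m : ℕ)
      (_ : closedBall (TopologicalSpace.denseSeq (StrongDual 𝕜 X) n) (1 / ((m : ℝ) + 1)) ⊆ U),
      {ω | ‖G ω - TopologicalSpace.denseSeq (StrongDual 𝕜 X) n‖ ≤ 1 / ((m : ℝ) + 1)} := by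
    ext ω
    simp only [mem_preimage, mem_iUnion, mem_ofPred_eq, exists_prop]
    constructor
    · intro h
      obtain ⟨ε, hε, hεU⟩ := Metric.isOpen_iff.1 hU _ h
      obtain ⟨m, hm⟩ := exists_nat_one_div_lt (show (0 : ℝ) < ε / 2 by positivity)
      obtain ⟨n, hn⟩ := (TopologicalSpace.denseRange_denseSeq (StrongDual 𝕜 X)).exists_dist_lt
        (G ω) (show (0 : ℝ) < 1 / ((m : ℝ) + 1) by positivity)
      refine ⟨n, m, fun g hg => hεU ?_, by rw [← dist_eq_norm]; exact hn.le⟩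
      rw [mem_closedBall] at hg
      rw [mem_ball]
      have := dist_triangle g (TopologicalSpace.denseSeq (StrongDual 𝕜 X) n) (G ω)
      rw [dist_comm] at hn
      linarith
    · rintro ⟨n, m, h, h'⟩
      exact h (by rwa [mem_closedBall, dist_eq_norm])
  rw [hU']
  exact MeasurableSet.iUnion fun n => MeasurableSet.iUnion fun m => MeasurableSet.iUnion fun _ =>
    hball _ _

theorem measurable_apply_of_stronglyMeasurable {E : Type*} [NormedAddCommGroup E]
    [NormedSpace 𝕜 E] {Z : Ω → StrongDual 𝕜 E} (hZ : ∀ f, Measurable fun ω => Z ω f) {G : Ω → E}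
    (hG : StronglyMeasurable G) : Measurable fun ω => Z ω (G ω) := by
  refine measurable_of_tendsto_metrizable (f := fun n ω => Z ω (hG.approx n ω)) (fun n => ?_) ?_
  · exact (hG.approx n).measurable_bind (fun b ω => Z ω b) hZ
  · rw [tendsto_pi_nhds]
    exact fun ω => ((Z ω).continuous.tendsto _).comp (hG.tendsto_approx ω)

end Measurability

/-! ### Trace duality under the approximation property -/

section AP

variable {𝕜 E Ω : Type*} [RCLike 𝕜] [NormedAddCommGroup E] [NormedSpace 𝕜 E] [MeasurableSpace Ω]

/-- Compact sets in a fixed ball, scaled by factors tending to zero, are jointly precompact. -/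
theorem isCompact_closure_iUnion_smul {C : ℕ → Set E} [CompleteSpace E] (hC : ∀ n, IsCompact (C n))
    {R : ℝ} (hR : ∀ n, C n ⊆ closedBall 0 R) :
    IsCompact (closure (⋃ n : ℕ, (fun x => ((2 : 𝕜) ^ n)⁻¹ • x) '' C n)) := by
  have : TotallyBounded (⋃ n : ℕ, (fun x => ((2 : 𝕜) ^ n)⁻¹ • x) '' C n) := by
    rw [Metric.totallyBounded_iff]
    intro ε hε
    obtain ⟨N, hN⟩ : ∃ N : ℕ, ∀ n, N ≤ n → ((2 : ℝ) ^ n)⁻¹ * R < ε := by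
      have h0 : Tendsto (fun n : ℕ => ((2 : ℝ) ^ n)⁻¹ * R) atTop (𝓝 (0 * R)) :=
        ((tendsto_inv_atTop_zero (𝕜 := ℝ)).comp
          (tendsto_pow_atTop_atTop_of_one_lt one_lt_two)).mul_const R
      rw [zero_mul] at h0
      exact eventually_atTop.1 (h0.eventually (gt_mem_nhds hε))
    have hfin : TotallyBounded (⋃ n ∈ Finset.range N, (fun x => ((2 : 𝕜) ^ n)⁻¹ • x) '' C n) :=
      ((Finset.range N).isCompact_biUnion fun n _ =>
        (hC n).image (continuous_const_smul _)).totallyBounded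
    obtain ⟨t, ht, ht'⟩ := Metric.totallyBounded_iff.1 hfin ε hε
    refine ⟨insert 0 t, ht.insert 0, ?_⟩
    intro y hy
    obtain ⟨n, x, hx, rfl⟩ := mem_iUnion.1 hy
    rw [biUnion_insert]
    by_cases hn : n < N
    · exact Or.inr (ht' (mem_biUnion (Finset.mem_coe.2 (Finset.mem_range.2 hn)) ⟨x, hx, rfl⟩))
    · left
      have hx' : ‖x‖ ≤ R := by simpa using hR n hx
      simp only [mem_ball, dist_zero_right, norm_smul, norm_inv, norm_pow, RCLike.norm_ofNat]
      exact (mul_le_mul_of_nonneg_left hx' (by positivity)).trans_lt (hN n (not_lt.1 hn))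
  exact isCompact_iff_totallyBounded_isComplete.2 ⟨this.closure, isClosed_closure.isComplete⟩

/-- Under the approximation property, finite rank operators approximate the identity along a
bounded strongly measurable function, up to a fixed integrable weight that does not depend on the
accuracy. The weight compensates for the lack of a bound on the operators outside a compact set. -/
theorem HasApproximationProperty.exists_integrable_weight [CompleteSpace E]
    [TopologicalSpace.SeparableSpace E]
    (hap : HasApproximationProperty 𝕜 E) {μ : Measure Ω} [IsFiniteMeasure μ] {G : Ω → E}
    (hG : StronglyMeasurable G) {R : ℝ} (hR : ∀ ω, ‖G ω‖ ≤ R) :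
    ∃ φ : Ω → ℝ≥0∞, ∫⁻ ω, φ ω ∂μ < ∞ ∧ ∀ ε : ℝ, 0 < ε → ∃ T : E →L[𝕜] E,
      FiniteDimensional 𝕜 (T : E →ₗ[𝕜] E).range ∧
        ∀ ω, ‖T (G ω) - G ω‖ₑ ≤ ENNReal.ofReal ε * φ ω := by
  classical
  borelize E
  have : SecondCountableTopology E := UniformSpace.secondCountable_of_separable _
  have : IsFiniteMeasure (μ.map G) := Measure.isFiniteMeasure_map μ G
  have htight := isTightMeasureSet_iff_exists_isCompact_measure_compl_le.1
    (isTightMeasureSet_singleton (μ := μ.map G))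
  have hK : ∀ n : ℕ, ∃ K : Set E, IsCompact K ∧ μ.map G Kᶜ ≤ ((4 : ℝ≥0∞) ^ n)⁻¹ := by
    intro n
    obtain ⟨K, hK, hK'⟩ := htight (((4 : ℝ≥0∞) ^ n)⁻¹) (by simp)
    exact ⟨K, hK, hK' _ rfl⟩
  choose K hKc hKμ using hK
  set C : ℕ → Set E := fun n => K n ∩ closedBall 0 R with hC
  have hCc : ∀ n, IsCompact (C n) := fun n => (hKc n).inter_right isClosed_closedBall
  have hmeas : ∀ n, MeasurableSet (G ⁻¹' (C n))ᶜ := fun n =>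
    (hG.measurable (hCc n).isClosed.measurableSet).compl
  have hCμ : ∀ n, μ (G ⁻¹' (C n))ᶜ ≤ ((4 : ℝ≥0∞) ^ n)⁻¹ := by
    intro n
    refine le_trans ?_ (hKμ n)
    rw [Measure.map_apply hG.measurable (hKc n).isClosed.measurableSet.compl]
    refine measure_mono fun ω hω hω' => hω ⟨hω', ?_⟩
    simpa using hR ω
  -- If `n` is the first index with `G ω ∈ C n`, the operator that is accurate to `ε` on `2⁻ⁿ • C n`
  -- has error at most `2ⁿ ε` at `G ω`, and `2ⁿ` is twice the term `n - 1` of the series if `0 < n`.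
  refine ⟨fun ω => 2 * (1 + ∑' n : ℕ, (2 : ℝ≥0∞) ^ n * (G ⁻¹' (C n))ᶜ.indicator 1 ω), ?_, ?_⟩
  · have hm : ∀ n : ℕ, Measurable fun ω =>
        (2 : ℝ≥0∞) ^ n * (G ⁻¹' (C n))ᶜ.indicator (1 : Ω → ℝ≥0∞) ω := fun n =>
      (measurable_one.indicator (hmeas n)).const_mul _
    rw [lintegral_const_mul' _ _ (by simp), lintegral_add_left measurable_const,
      lintegral_tsum fun n => (hm n).aemeasurable]
    refine ENNReal.mul_lt_top (by simp) (ENNReal.add_lt_top.2 ⟨by simp, ?_⟩)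
    have hle : ∑' n : ℕ, ∫⁻ ω, (2 : ℝ≥0∞) ^ n * (G ⁻¹' (C n))ᶜ.indicator (1 : Ω → ℝ≥0∞) ω ∂μ ≤
        ∑' n : ℕ, ((2 : ℝ≥0∞)⁻¹) ^ n := by
      refine ENNReal.tsum_le_tsum fun n => ?_
      rw [lintegral_const_mul' _ _ (by simp), lintegral_indicator_one (hmeas n)]
      refine (mul_le_mul_right (hCμ n) _).trans (le_of_eq ?_)
      rw [show (4 : ℝ≥0∞) = 2 * 2 by norm_num, mul_pow,
        ENNReal.mul_inv (by simp) (by simp), ← mul_assoc,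
        ENNReal.mul_inv_cancel (by simp) (by simp), one_mul, ENNReal.inv_pow]
    refine hle.trans_lt ?_
    rw [ENNReal.tsum_geometric]
    norm_num
  · intro ε hε
    obtain ⟨T, hT, hTK⟩ := hap _ (isCompact_closure_iUnion_smul (𝕜 := 𝕜) hCc
      (fun n => inter_subset_right)) ε hε
    refine ⟨T, hT, fun ω => ?_⟩
    by_cases hω : ∃ n, G ω ∈ C n
    · have hscale : ∀ n, G ω ∈ C n → ‖T (G ω) - G ω‖ₑ ≤ ENNReal.ofReal ε * 2 ^ n := by
        intro n hn
        have h1 := hTK _ (subset_closure (mem_iUnion.2 ⟨n, G ω, hn, rfl⟩))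
        rw [map_smul, ← smul_sub, norm_smul, norm_inv, norm_pow, RCLike.norm_ofNat,
          inv_mul_le_iff₀ (by positivity)] at h1
        rw [← ofReal_norm, mul_comm]
        refine (ENNReal.ofReal_le_ofReal h1).trans (le_of_eq ?_)
        rw [ENNReal.ofReal_mul (by positivity), ENNReal.ofReal_pow (by norm_num)]
        simp
      refine (hscale _ (Nat.find_spec hω)).trans (mul_le_mul_right ?_ _)
      rcases hn : Nat.find hω with _ | m
      · rw [pow_zero]
        exact le_trans (by norm_num) (mul_le_mul_right (le_self_add (a := (1 : ℝ≥0∞))) 2)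
      · have hm : ω ∈ (G ⁻¹' (C m))ᶜ := Nat.find_min hω (by omega)
        rw [pow_succ']
        refine mul_le_mul_right (le_trans ?_ le_add_self) _
        refine le_trans (le_of_eq ?_)
          (ENNReal.le_tsum (f := fun n : ℕ => (2 : ℝ≥0∞) ^ n *
            (G ⁻¹' (C n))ᶜ.indicator (1 : Ω → ℝ≥0∞) ω) m)
        simp [indicator_of_mem hm]
    · have htop : ∑' n : ℕ, (2 : ℝ≥0∞) ^ n * (G ⁻¹' (C n))ᶜ.indicator 1 ω = ∞ := by
        refine top_unique ?_
        rw [← ENNReal.tsum_const_eq_top_of_ne_zero (α := ℕ) one_ne_zero]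
        refine ENNReal.tsum_le_tsum fun n => ?_
        have hm : ω ∈ (G ⁻¹' (C n))ᶜ := fun h => hω ⟨n, h⟩
        rw [indicator_of_mem hm]
        simpa using one_le_pow₀ (one_le_two (α := ℝ≥0∞))
      beta_reduce
      rw [htop]
      simp [ENNReal.mul_top, hε]

theorem integrable_of_measurable_of_norm_le {F : Type*} [NormedAddCommGroup F] {μ : Measure Ω}
    [IsFiniteMeasure μ] {f : Ω → F} (hf : StronglyMeasurable f) {B : ℝ} (hB : ∀ ω, ‖f ω‖ ≤ B) :
    Integrable f μ :=
  Integrable.of_bound hf.aestronglyMeasurable B (Eventually.of_forall hB)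

/-- A functional `T ↦ ∫ Z (T G) dμ` on operators that vanishes at the rank one operators
`g ↦ g x • f`, `x ∈ X`, vanishes at all finite rank operators (including those `g ↦ z g • f` with
`z` in the bidual), hence at the identity. -/
theorem HasApproximationProperty.integral_apply_eq_zero {X : Type*} [NormedAddCommGroup X]
    [NormedSpace 𝕜 X] [TopologicalSpace.SeparableSpace (StrongDual 𝕜 X)]
    (hap : HasApproximationProperty 𝕜 (StrongDual 𝕜 X)) {μ : Measure Ω} [IsFiniteMeasure μ]
    {G : Ω → StrongDual 𝕜 X} (hG : StronglyMeasurable G) {R : ℝ} (hR : ∀ ω, ‖G ω‖ ≤ R)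
    {Z : Ω → StrongDual 𝕜 (StrongDual 𝕜 X)} (hZ : ∀ f, Measurable fun ω => Z ω f)
    {B : ℝ} (hB : ∀ ω, ‖Z ω‖ ≤ B)
    (h : ∀ (f : StrongDual 𝕜 X) (x : X), ∫ ω, Z ω f * G ω x ∂μ = 0) :
    ∫ ω, Z ω (G ω) ∂μ = 0 := by
  have hZbound : ∀ (v : StrongDual 𝕜 X) ω, ‖Z ω v‖ ≤ B * ‖v‖ := fun v ω =>
    (Z ω).le_of_opNorm_le (hB ω) v
  have hZG : ∀ T : StrongDual 𝕜 X →L[𝕜] StrongDual 𝕜 X, Integrable (fun ω => Z ω (T (G ω))) μ := by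
    intro T
    refine integrable_of_measurable_of_norm_le (B := B * (‖T‖ * R))
      (measurable_apply_of_stronglyMeasurable hZ
        (T.continuous.comp_stronglyMeasurable hG)).stronglyMeasurable fun ω => ?_
    have hB0 : 0 ≤ B := (norm_nonneg _).trans (hB ω)
    exact (hZbound _ ω).trans (mul_le_mul_of_nonneg_left (T.le_opNorm_of_le (hR ω)) hB0)
  have hsmul : ∀ f : StrongDual 𝕜 X, Integrable (fun ω => Z ω f • G ω) μ := by
    intro f
    refine integrable_of_measurable_of_norm_le (B := B * ‖f‖ * R)
      ((hZ f).stronglyMeasurable.smul hG) fun ω => ?_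
    rw [norm_smul]
    exact mul_le_mul (hZbound f ω) (hR ω) (norm_nonneg _) ((norm_nonneg _).trans (hZbound f ω))
  have hsmul0 : ∀ f : StrongDual 𝕜 X, ∫ ω, Z ω f • G ω ∂μ = 0 := by
    intro f
    ext x
    have h1 := (ContinuousLinearMap.apply 𝕜 𝕜 x).integral_comp_comm (hsmul f)
    simp only [ContinuousLinearMap.apply_apply, smul_apply, smul_eq_mul] at h1
    rw [← h1, h f x]
    simp
  have hfin : ∀ T : StrongDual 𝕜 X →L[𝕜] StrongDual 𝕜 X,
      FiniteDimensional 𝕜 (T : StrongDual 𝕜 X →ₗ[𝕜] StrongDual 𝕜 X).range →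
        ∫ ω, Z ω (T (G ω)) ∂μ = 0 := by
    intro T hT
    set b := Module.finBasis 𝕜 (T : StrongDual 𝕜 X →ₗ[𝕜] StrongDual 𝕜 X).range with hb
    set z : Fin _ → StrongDual 𝕜 (StrongDual 𝕜 X) := fun i =>
      (LinearMap.toContinuousLinearMap (b.coord i)) ∘L
        (T.codRestrict (T : StrongDual 𝕜 X →ₗ[𝕜] StrongDual 𝕜 X).range
          (fun g => ⟨g, rfl⟩)) with hz
    have hTz : ∀ g, T g = ∑ i, z i g • (b i : StrongDual 𝕜 X) := by
      intro g
      have h1 := b.sum_repr ⟨T g, ⟨g, rfl⟩⟩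
      have h2 := congrArg Subtype.val h1
      simp only [Submodule.coe_sum, Submodule.coe_smul] at h2
      exact h2.symm
    have h3 : ∀ i, Integrable (fun ω => z i (Z ω (b i : StrongDual 𝕜 X) • G ω)) μ := fun i =>
      (z i).integrable_comp (hsmul _)
    have h4 : ∀ ω, Z ω (T (G ω)) = ∑ i, z i (Z ω (b i : StrongDual 𝕜 X) • G ω) := by
      intro ω
      rw [hTz, map_sum]
      refine Finset.sum_congr rfl fun i _ => ?_
      rw [map_smul, map_smul, smul_eq_mul, smul_eq_mul, mul_comm]
    simp_rw [h4]
    rw [integral_finsetSum _ fun i _ => h3 i]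
    refine Finset.sum_eq_zero fun i _ => ?_
    rw [(z i).integral_comp_comm (hsmul _), hsmul0, map_zero]
  obtain ⟨φ, hφ, hφT⟩ := hap.exists_integrable_weight (μ := μ) hG hR
  have hbound : ∀ ε : ℝ, 0 < ε → ‖∫ ω, Z ω (G ω) ∂μ‖ ≤
      ε * (ENNReal.ofReal B * ∫⁻ ω, φ ω ∂μ).toReal := by
    intro ε hε
    obtain ⟨T, hT, hTG⟩ := hφT ε hε
    have h1 : ∫ ω, Z ω (G ω) ∂μ = ∫ ω, Z ω (G ω) - Z ω (T (G ω)) ∂μ := by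
      have h0 := integral_sub (hZG (ContinuousLinearMap.id 𝕜 _)) (hZG T)
      rw [hfin T hT, sub_zero] at h0
      exact h0.symm
    have h2 : ‖∫ ω, Z ω (G ω) ∂μ‖ₑ ≤
        ENNReal.ofReal ε * (ENNReal.ofReal B * ∫⁻ ω, φ ω ∂μ) := by
      rw [h1]
      refine (enorm_integral_le_lintegral_enorm _).trans ?_
      rw [← lintegral_const_mul' _ _ ENNReal.ofReal_ne_top,
        ← lintegral_const_mul' _ _ ENNReal.ofReal_ne_top]
      refine lintegral_mono fun ω => ?_
      rw [← map_sub, ← mul_assoc, mul_comm (ENNReal.ofReal ε), mul_assoc]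
      have h3 : ‖Z ω (G ω - T (G ω))‖ₑ ≤ ENNReal.ofReal B * ‖G ω - T (G ω)‖ₑ := by
        rw [← ofReal_norm, ← ofReal_norm, ← ENNReal.ofReal_mul' (norm_nonneg _)]
        exact ENNReal.ofReal_le_ofReal (hZbound _ ω)
      refine h3.trans (mul_le_mul_right ?_ _)
      rw [← enorm_neg, neg_sub]
      exact hTG ω
    have h4 := ENNReal.toReal_mono (ENNReal.mul_ne_top ENNReal.ofReal_ne_top
      (ENNReal.mul_ne_top ENNReal.ofReal_ne_top hφ.ne)) h2
    rwa [toReal_enorm, ENNReal.toReal_mul, ENNReal.toReal_ofReal hε.le] at h4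
  set c := (ENNReal.ofReal B * ∫⁻ ω, φ ω ∂μ).toReal with hc
  have hc0 : 0 ≤ c := ENNReal.toReal_nonneg
  rw [← norm_le_zero_iff]
  refine le_of_forall_pos_le_add fun δ hδ => ?_
  refine (hbound (δ / (c + 1)) (by positivity)).trans ?_
  rw [zero_add, div_mul_eq_mul_div, div_le_iff₀ (by positivity)]
  nlinarith

end AP

/-! ### Extensions of multilinear maps are determined by products of functionals -/

section Arens

variable {𝕜 X V Ω : Type*} [RCLike 𝕜] [NormedAddCommGroup X] [NormedSpace 𝕜 X]
  [NormedAddCommGroup V] [NormedSpace 𝕜 V] [MeasurableSpace Ω]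

theorem arensSlice_comp_apply {m : ℕ} (Ψ : X [×(m + 1)]→L[𝕜] V)
    (z : Fin m → StrongDual 𝕜 (StrongDual 𝕜 X)) (w : StrongDual 𝕜 V) (x : X) :
    arensSlice (w.compContinuousMultilinearMap Ψ) z x = arens (Ψ.curryLeft x) z w := rfl

theorem arens_zero_apply (Ψ : X [×0]→L[𝕜] V)
    (z : Fin 0 → StrongDual 𝕜 (StrongDual 𝕜 X)) (w : StrongDual 𝕜 V) :
    arens Ψ z w = w (Ψ 0) := rfl

theorem measurable_arens (hsep : TopologicalSpace.SeparableSpace (StrongDual 𝕜 X)) {m : ℕ}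
    (Ψ : X [×m]→L[𝕜] V) {Z : Fin m → Ω → StrongDual 𝕜 (StrongDual 𝕜 X)}
    (hZ : ∀ a f, Measurable fun ω => Z a ω f) {W : Ω → StrongDual 𝕜 V}
    (hW : ∀ v, Measurable fun ω => W ω v) :
    Measurable fun ω => arens Ψ (fun a => Z a ω) (W ω) := by
  induction m with
  | zero => exact hW _
  | succ m ih =>
    refine measurable_apply_of_stronglyMeasurable (hZ 0)
      (G := fun ω => arensSlice ((W ω).compContinuousMultilinearMap Ψ) (fun a => Z a.succ ω))
      (stronglyMeasurable_of_forall_apply hsep fun x => ?_)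
    exact ih (Ψ.curryLeft x) (fun a f => hZ a.succ f)

theorem norm_arensSlice_le {m : ℕ} (Ψ : X [×(m + 1)]→L[𝕜] V)
    {z : Fin m → StrongDual 𝕜 (StrongDual 𝕜 X)} {B : ℝ} (hB0 : 0 ≤ B) (hz : ∀ a, ‖z a‖ ≤ B)
    {w : StrongDual 𝕜 V} (hw : ‖w‖ ≤ B) :
    ‖arensSlice (w.compContinuousMultilinearMap Ψ) z‖ ≤
      ‖arensForm 𝕜 X m‖ * (B * ‖Ψ‖) * B ^ m := by
  have hw' : ‖w.compContinuousMultilinearMap Ψ‖ ≤ B * ‖Ψ‖ :=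
    (w.norm_compContinuousMultilinearMap_le Ψ).trans
      (mul_le_mul_of_nonneg_right hw (norm_nonneg _))
  refine ContinuousLinearMap.opNorm_le_bound _ (by positivity) fun x => ?_
  rw [arensSlice_apply]
  have h1 : ‖(w.compContinuousMultilinearMap Ψ).curryLeft x‖ ≤ B * ‖Ψ‖ * ‖x‖ :=
    (ContinuousLinearMap.le_opNorm _ _).trans
      (mul_le_mul_of_nonneg_right (by rwa [ContinuousMultilinearMap.curryLeft_norm])
        (norm_nonneg _))
  calc _ ≤ ‖arensForm 𝕜 X m ((w.compContinuousMultilinearMap Ψ).curryLeft x)‖ * ∏ a, ‖z a‖ :=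
        ContinuousMultilinearMap.le_opNorm _ _
    _ ≤ (‖arensForm 𝕜 X m‖ * (B * ‖Ψ‖ * ‖x‖)) * ∏ _a : Fin m, B := by
        gcongr
        · exact (arensForm 𝕜 X m).le_opNorm_of_le h1
        · exact hz _
    _ = _ := by
        rw [Finset.prod_const, Finset.card_univ, Fintype.card_fin]
        ring

/-- A finite measure that annihilates all products `Z₁(f₁) ⋯ Z_m(f_m) W(v)` annihilates the
canonical extension of every continuous `m`-linear map. The extension is weak-star
continuous in its first variable only, so it is not a weak-star limit of maps of finite type in all
variables at once; the induction treats one variable at a time. -/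
theorem integral_arens_eq_zero (hsep : TopologicalSpace.SeparableSpace (StrongDual 𝕜 X))
    (hap : HasApproximationProperty 𝕜 (StrongDual 𝕜 X)) {μ : Measure Ω} [IsFiniteMeasure μ]
    {m : ℕ} (Ψ : X [×m]→L[𝕜] V) {Z : Fin m → Ω → StrongDual 𝕜 (StrongDual 𝕜 X)}
    (hZ : ∀ a f, Measurable fun ω => Z a ω f) {W : Ω → StrongDual 𝕜 V}
    (hW : ∀ v, Measurable fun ω => W ω v) {B : ℝ} (hZB : ∀ a ω, ‖Z a ω‖ ≤ B)
    {B' : ℝ} (hWB : ∀ ω, ‖W ω‖ ≤ B')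
    (h : ∀ (f : Fin m → StrongDual 𝕜 X) (v : V),
      ∫ ω, (∏ a, Z a ω (f a)) * W ω v ∂μ = 0) :
    ∫ ω, arens Ψ (fun a => Z a ω) (W ω) ∂μ = 0 := by
  induction m generalizing W B' with
  | zero => simpa [arens_zero_apply] using h Fin.elim0 (Ψ 0)
  | succ m ih =>
    refine hap.integral_apply_eq_zero
      (G := fun ω => arensSlice ((W ω).compContinuousMultilinearMap Ψ) (fun a => Z a.succ ω))
      (stronglyMeasurable_of_forall_apply hsep fun x =>
        measurable_arens hsep (Ψ.curryLeft x) (fun a f => hZ a.succ f) hW)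
      (R := ‖arensForm 𝕜 X m‖ * (max B B' * ‖Ψ‖) * max B B' ^ m) (fun ω => ?_)
      (hZ 0) (hZB 0) fun f x => ?_
    · exact norm_arensSlice_le Ψ ((norm_nonneg _).trans ((hWB ω).trans (le_max_right _ _)))
        (fun a => (hZB _ ω).trans (le_max_left _ _)) ((hWB ω).trans (le_max_right _ _))
    · -- The scalar factor `Z₀(f)` is absorbed into `W`.
      have h1 := ih (Ψ.curryLeft x) (Z := fun a => Z a.succ) (fun a f => hZ a.succ f)
        (W := fun ω => Z 0 ω f • W ω) (fun v => (hZ 0 f).mul (hW v)) (fun a => hZB a.succ)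
        (B' := B * ‖f‖ * B') (fun ω => ?_) (fun g v => ?_)
      · simpa [arensSlice_comp_apply, Fin.tail] using h1
      · rw [norm_smul]
        have := (Z 0 ω).le_of_opNorm_le (hZB 0 ω) f
        exact mul_le_mul this (hWB ω) (norm_nonneg _) ((norm_nonneg _).trans this)
      · rw [← h (Fin.cons f g) v]
        refine integral_congr_ae (Eventually.of_forall fun ω => ?_)
        simp only [Fin.prod_univ_succ, Fin.cons_zero, Fin.cons_succ, smul_apply, smul_eq_mul]
        ring

end Arens

/-! ### The extension of a polynomial does not increase the norm -/

section DavieGamelin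

variable {𝕜 X : Type*} [RCLike 𝕜] [NormedAddCommGroup X] [NormedSpace 𝕜 X]

open NormedSpace (inclusionInDoubleDual)

theorem arensForm_inclusionInDoubleDual {N : ℕ} (φ : X [×N]→L[𝕜] 𝕜) (x : Fin N → X) :
    arensForm 𝕜 X N φ (fun i => inclusionInDoubleDual 𝕜 X (x i)) = φ x := by
  induction N with
  | zero => rw [arensForm_zero, Subsingleton.elim x 0]
  | succ N ih =>
    rw [arensForm_succ, NormedSpace.dual_def, arensSlice_apply]
    refine (ih (φ.curryLeft (x 0)) (Fin.tail x)).trans ?_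
    rw [ContinuousMultilinearMap.curryLeft_apply, Fin.cons_self_tail]

theorem arens_inclusionInDoubleDual {V : Type*} [NormedAddCommGroup V] [NormedSpace 𝕜 V] {N : ℕ}
    (Φ : X [×N]→L[𝕜] V) (x : Fin N → X) (w : StrongDual 𝕜 V) :
    arens Φ (fun i => inclusionInDoubleDual 𝕜 X (x i)) w = w (Φ x) := by
  rw [arens_apply, arensForm_inclusionInDoubleDual]
  rfl

theorem symm_curryLeft {W : Type*} [NormedAddCommGroup W] [NormedSpace 𝕜 W] {N : ℕ}
    {φ : X [×(N + 1)]→L[𝕜] W}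
    (hφ : ∀ (σ : Equiv.Perm (Fin (N + 1))) (v : Fin (N + 1) → X), φ (v ∘ σ) = φ v) (x : X)
    (σ : Equiv.Perm (Fin N)) (v : Fin N → X) : φ.curryLeft x (v ∘ σ) = φ.curryLeft x v := by
  rw [ContinuousMultilinearMap.curryLeft_apply, ContinuousMultilinearMap.curryLeft_apply,
    ← hφ (Equiv.Perm.decomposeFin.symm (0, σ)) (Fin.cons x v)]
  congr 1
  ext i
  refine Fin.cases ?_ (fun i => ?_) i <;> simp

theorem symm_curryLeft_swap {N : ℕ} {φ : X [×(N + 2)]→L[𝕜] 𝕜}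
    (hφ : ∀ (σ : Equiv.Perm (Fin (N + 2))) (v : Fin (N + 2) → X), φ (v ∘ σ) = φ v) (x y : X) :
    (φ.curryLeft x).curryLeft y = (φ.curryLeft y).curryLeft x := by
  ext t
  simp only [ContinuousMultilinearMap.curryLeft_apply]
  rw [← hφ (Equiv.swap 0 1)]
  congr 1
  ext i
  refine Fin.cases ?_ (fun i => Fin.cases ?_ (fun i => ?_) i) i
  · simp
  · simp
  · rw [Function.comp_apply, Equiv.swap_apply_of_ne_of_ne (Fin.succ_ne_zero _)
      (by rw [← Fin.succ_zero_eq_one]; exact fun h => Fin.succ_ne_zero _ (Fin.succ_injective _ h))]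
    simp

theorem arensForm_cons {N : ℕ} (φ : X [×(N + 1)]→L[𝕜] 𝕜) (a : StrongDual 𝕜 (StrongDual 𝕜 X))
    (t : Fin N → StrongDual 𝕜 (StrongDual 𝕜 X)) :
    arensForm 𝕜 X (N + 1) φ (Fin.cons a t) = a (arensSlice φ t) := by
  rw [arensForm_succ, Fin.cons_zero, Fin.tail_cons]

/-- The canonical extension of a symmetric form need not be symmetric on `X''`, but it is on the
subspaces `X + 𝕜 z`. -/
theorem arensForm_swap {N : ℕ} {φ : X [×(N + 2)]→L[𝕜] 𝕜}
    (hφ : ∀ (σ : Equiv.Perm (Fin (N + 2))) (v : Fin (N + 2) → X), φ (v ∘ σ) = φ v)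
    (z : StrongDual 𝕜 (StrongDual 𝕜 X)) (x y : X) (c c' : 𝕜)
    (t : Fin N → StrongDual 𝕜 (StrongDual 𝕜 X)) :
    arensForm 𝕜 X (N + 2) φ (Fin.cons (inclusionInDoubleDual 𝕜 X x + c • z)
        (Fin.cons (inclusionInDoubleDual 𝕜 X y + c' • z) t)) =
      arensForm 𝕜 X (N + 2) φ (Fin.cons (inclusionInDoubleDual 𝕜 X y + c' • z)
        (Fin.cons (inclusionInDoubleDual 𝕜 X x + c • z) t)) := by
  set F : StrongDual 𝕜 (StrongDual 𝕜 X) → StrongDual 𝕜 (StrongDual 𝕜 X) → 𝕜 := fun a d =>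
    arensForm 𝕜 X (N + 2) φ (Fin.cons a (Fin.cons d t)) with hF
  have hleft : ∀ a b d (s : 𝕜), F (a + s • b) d = F a d + s * F b d := by
    intro a b d s
    simp only [hF, arensForm_cons, add_apply, smul_apply, smul_eq_mul]
  have hright : ∀ a b d (s : 𝕜), F a (b + s • d) = F a b + s * F a d := by
    intro a b d s
    have h1 : arensSlice φ (Fin.cons (b + s • d) t) =
        arensSlice φ (Fin.cons b t) + s • arensSlice φ (Fin.cons d t) := by
      ext x
      simp only [arensSlice_apply, arensForm_cons, add_apply, smul_apply]
    simp only [hF, arensForm_cons, h1, map_add, map_smul, smul_eq_mul]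
  have hmixed : ∀ (u : X) d, F (inclusionInDoubleDual 𝕜 X u) d =
      F d (inclusionInDoubleDual 𝕜 X u) := by
    intro u d
    simp only [hF, arensForm_cons, NormedSpace.dual_def, arensSlice_apply]
    congr 1
    ext v
    simp only [arensSlice_apply, arensForm_cons, NormedSpace.dual_def]
    rw [symm_curryLeft_swap hφ]
  change F _ _ = F _ _
  rw [hleft, hright z, hmixed, hright _ _ z, hleft _ z z, ← hmixed y z]

theorem arensForm_update {N : ℕ} {φ : X [×(N + 1)]→L[𝕜] 𝕜}
    (hφ : ∀ (σ : Equiv.Perm (Fin (N + 1))) (v : Fin (N + 1) → X), φ (v ∘ σ) = φ v)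
    (z : StrongDual 𝕜 (StrongDual 𝕜 X)) (x y : X) (c c' : 𝕜) (i : Fin (N + 1)) :
    arensForm 𝕜 X (N + 1) φ (Function.update (fun _ => inclusionInDoubleDual 𝕜 X x + c • z) i
        (inclusionInDoubleDual 𝕜 X y + c' • z)) =
      (inclusionInDoubleDual 𝕜 X y + c' • z)
        (arensSlice φ fun _ => inclusionInDoubleDual 𝕜 X x + c • z) := by
  induction N with
  | zero =>
    rw [Fin.fin_one_eq_zero i, arensForm_succ, Function.update_self]
    congr 2
  | succ N ih =>
    set a := inclusionInDoubleDual 𝕜 X x + c • z with ha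
    set d := inclusionInDoubleDual 𝕜 X y + c' • z with hd
    refine Fin.cases ?_ (fun i => ?_) i
    · rw [arensForm_succ, Function.update_self, Fin.tail_update_zero]
      rfl
    · rw [arensForm_succ, Function.update_of_ne (Fin.succ_ne_zero i).symm, Fin.tail_update_succ]
      have h1 : arensSlice φ (Function.update (Fin.tail fun _ => a) i d) =
          arensSlice φ (Fin.cons d fun _ => a) := by
        ext v
        rw [arensSlice_apply, arensSlice_apply, arensForm_cons]
        exact ih (symm_curryLeft hφ v) i
      rw [h1, ← arensForm_cons, arensForm_swap hφ, arensForm_cons]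
      congr 2

/-- First order Taylor expansion of a multilinear map along the diagonal: expanding by
multilinearity, the terms with at least two factors `h • b` are of order `h²`. -/
theorem norm_map_add_smul_sub_le {V : Type*} [NormedAddCommGroup V] [NormedSpace 𝕜 V] {j : ℕ}
    (ψ : V [×j]→L[𝕜] 𝕜) {a b : V} (ha : ‖a‖ ≤ 1) (hb : ‖b‖ ≤ 1) {h : ℝ} (h0 : 0 ≤ h)
    (h1 : h ≤ 1) :
    ‖ψ (fun _ => a + (h : 𝕜) • b) - ψ (fun _ => a) -
      (h : 𝕜) * ∑ i, ψ (Function.update (fun _ => a) i b)‖ ≤ 2 ^ j * ‖ψ‖ * h ^ 2 := by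
  have hs : ∀ s : Finset (Fin j), ψ (s.piecewise (fun _ => (h : 𝕜) • b) fun _ => a) =
      (h : 𝕜) ^ s.card * ψ (s.piecewise (fun _ => b) fun _ => a) := by
    intro s
    have := ψ.map_piecewise_smul (fun _ => (h : 𝕜)) (s.piecewise (fun _ => b) fun _ => a) s
    rw [Finset.prod_const, smul_eq_mul] at this
    rw [← this]
    congr 1
    ext i
    by_cases hi : i ∈ s <;> simp [hi]
  have hbound : ∀ s : Finset (Fin j), ‖ψ (s.piecewise (fun _ => b) fun _ => a)‖ ≤ ‖ψ‖ := by
    intro s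
    refine (ψ.le_opNorm _).trans (mul_le_of_le_one_right (norm_nonneg _) ?_)
    refine Finset.prod_le_one (fun _ _ => norm_nonneg _) fun i _ => ?_
    by_cases hi : i ∈ s <;> simp [hi, ha, hb]
  have hexp : ψ (fun _ => a + (h : 𝕜) • b) = ∑ s : Finset (Fin j),
      (h : 𝕜) ^ s.card * ψ (s.piecewise (fun _ => b) fun _ => a) := by
    rw [← Finset.sum_congr rfl fun s _ => hs s, ← ψ.map_add_univ]
    congr 1
    ext i
    simp [add_comm]
  have hzero : ψ (fun _ => a) = ∑ s : Finset (Fin j) with s.card = 0,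
      (h : 𝕜) ^ s.card * ψ (s.piecewise (fun _ => b) fun _ => a) := by
    simp [Finset.filter_eq']
  have hone : (h : 𝕜) * ∑ i, ψ (Function.update (fun _ => a) i b) =
      ∑ s : Finset (Fin j) with s.card = 1,
        (h : 𝕜) ^ s.card * ψ (s.piecewise (fun _ => b) fun _ => a) := by
    have : (Finset.univ.filter fun s : Finset (Fin j) => s.card = 1) =
        Finset.univ.map ⟨singleton, Finset.singleton_injective⟩ := by
      rw [← Finset.powersetCard_one]
      ext s
      simp [Finset.mem_powersetCard]
    rw [this, Finset.sum_map, Finset.mul_sum]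
    refine Finset.sum_congr rfl fun i _ => ?_
    simp [Finset.piecewise_singleton]
  have hsplit : ψ (fun _ => a + (h : 𝕜) • b) - ψ (fun _ => a) -
      (h : 𝕜) * ∑ i, ψ (Function.update (fun _ => a) i b) =
      ∑ s : Finset (Fin j) with 2 ≤ s.card,
        (h : 𝕜) ^ s.card * ψ (s.piecewise (fun _ => b) fun _ => a) := by
    rw [hexp, hzero, hone, sub_sub, sub_eq_iff_eq_add]
    simp only [Finset.sum_filter]
    rw [← Finset.sum_add_distrib, ← Finset.sum_add_distrib]
    refine Finset.sum_congr rfl fun s _ => ?_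
    rcases hc : s.card with _ | _ | m <;> simp
  rw [hsplit]
  refine (norm_sum_le _ _).trans ?_
  calc _ ≤ ∑ s : Finset (Fin j) with 2 ≤ s.card, h ^ 2 * ‖ψ‖ := by
        refine Finset.sum_le_sum fun s hs => ?_
        rw [norm_mul, norm_pow, RCLike.norm_ofReal, abs_of_nonneg h0]
        exact mul_le_mul (pow_le_pow_of_le_one h0 h1 (Finset.mem_filter.1 hs).2) (hbound s)
          (norm_nonneg _) (by positivity)
    _ ≤ ∑ s : Finset (Fin j), h ^ 2 * ‖ψ‖ :=
        Finset.sum_le_sum_of_subset_of_nonneg (Finset.filter_subset _ _)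
          fun _ _ _ => by positivity
    _ = _ := by
        simp
        ring

theorem exists_norm_le_one_norm_apply_sub_le {z : StrongDual 𝕜 (StrongDual 𝕜 X)} (hz : ‖z‖ ≤ 1)
    (f : StrongDual 𝕜 X) {ε : ℝ} (hε : 0 < ε) : ∃ y : X, ‖y‖ ≤ 1 ∧ ‖z f - f y‖ ≤ ε := by
  have hzf : ‖z f‖ ≤ ‖f‖ := z.le_of_opNorm_le_of_le hz le_rfl |>.trans (one_mul _).le
  rcases eq_or_ne ‖f‖ 0 with h0 | h0
  · refine ⟨0, by simp, ?_⟩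
    rw [map_zero, sub_zero]
    exact hzf.trans (h0.le.trans hε.le)
  have hpos : 0 < ‖f‖ := lt_of_le_of_ne (norm_nonneg _) h0.symm
  obtain ⟨x, hx, hx'⟩ := ContinuousLinearMap.exists_lt_apply_of_lt_opNorm f
    (show max 0 (‖f‖ - ε) < ‖f‖ from max_lt hpos (by linarith))
  have hfx : f x ≠ 0 := norm_pos_iff.1 ((le_max_left _ _).trans_lt hx')
  refine ⟨(z f / (‖f‖ : 𝕜) * ((‖f x‖ : 𝕜) / f x)) • x, ?_, ?_⟩
  · rw [norm_smul, norm_mul, norm_div, norm_div, RCLike.norm_ofReal, RCLike.norm_ofReal, abs_norm,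
      abs_norm, div_self (norm_ne_zero_iff.2 hfx), mul_one]
    exact mul_le_one₀ ((div_le_one hpos).2 hzf) (norm_nonneg _) hx.le
  · rw [map_smul, smul_eq_mul, mul_assoc, div_mul_cancel₀ _ hfx]
    have h2 : z f - z f / (‖f‖ : 𝕜) * (‖f x‖ : 𝕜) =
        z f / (‖f‖ : 𝕜) * ((‖f‖ - ‖f x‖ : ℝ) : 𝕜) := by
      have : (‖f‖ : 𝕜) ≠ 0 := by exact_mod_cast h0
      push_cast
      field_simp
    have h3 : ‖f x‖ ≤ ‖f‖ := f.unit_le_opNorm x hx.le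
    rw [h2, norm_mul, norm_div, RCLike.norm_ofReal, RCLike.norm_ofReal, abs_norm,
      abs_of_nonneg (by linarith)]
    have h4 := (le_max_right _ _).trans_lt hx'
    exact (mul_le_of_le_one_left (by linarith) ((div_le_one hpos).2 hzf)).trans (by linarith)

/-- The derivative of a symmetric form along the diagonal of `X + 𝕜 z` is given by an element
of `X'`. -/
theorem exists_sum_arensForm_update_eq {j : ℕ} {φ : X [×j]→L[𝕜] 𝕜}
    (hφ : ∀ (σ : Equiv.Perm (Fin j)) (v : Fin j → X), φ (v ∘ σ) = φ v)
    (z : StrongDual 𝕜 (StrongDual 𝕜 X)) (x : X) (c : 𝕜) :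
    ∃ f : StrongDual 𝕜 X, ∀ (y : X) (c' : 𝕜),
      ∑ i, arensForm 𝕜 X j φ (Function.update (fun _ => inclusionInDoubleDual 𝕜 X x + c • z) i
        (inclusionInDoubleDual 𝕜 X y + c' • z)) = (inclusionInDoubleDual 𝕜 X y + c' • z) f := by
  cases j with
  | zero => exact ⟨0, fun y c' => by simp⟩
  | succ j =>
    refine ⟨(j + 1) • arensSlice φ fun _ => inclusionInDoubleDual 𝕜 X x + c • z,
      fun y c' => ?_⟩
    rw [Finset.sum_congr rfl fun i _ => arensForm_update hφ z x y c c' i, Finset.sum_const,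
      Finset.card_univ, Fintype.card_fin, map_nsmul]

theorem norm_inclusionInDoubleDual_le (x : X) : ‖inclusionInDoubleDual 𝕜 X x‖ ≤ ‖x‖ :=
  NormedSpace.double_dual_bound 𝕜 X x

/-- A small multiple `h z` of a point of the bidual is replaced by `h y` with `y ∈ X`, at the cost
of an error of second order in `h`. -/
theorem exists_norm_sum_arensForm_sub_le (k : ℕ) {φ : (j : ℕ) → X [×j]→L[𝕜] 𝕜}
    (hφ : ∀ (j : ℕ) (σ : Equiv.Perm (Fin j)) (v : Fin j → X), φ j (v ∘ σ) = φ j v)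
    {z : StrongDual 𝕜 (StrongDual 𝕜 X)} (hz : ‖z‖ ≤ 1) {r h : ℝ} (h0 : 0 < h) (hr : h ≤ r)
    (hr1 : r ≤ 1) {x : X} (hx : ‖x‖ ≤ 1 - r) :
    ∃ x' : X, ‖x'‖ ≤ 1 - (r - h) ∧
      ‖∑ j ∈ Finset.range (k + 1),
          arensForm 𝕜 X j (φ j) (fun _ => inclusionInDoubleDual 𝕜 X x + (r : 𝕜) • z) -
        ∑ j ∈ Finset.range (k + 1), arensForm 𝕜 X j (φ j)
          (fun _ => inclusionInDoubleDual 𝕜 X x' + ((r - h : ℝ) : 𝕜) • z)‖ ≤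
        (1 + 2 * ∑ j ∈ Finset.range (k + 1), 2 ^ j * ‖arensForm 𝕜 X j (φ j)‖) * h ^ 2 := by
  choose f hf using fun j => exists_sum_arensForm_update_eq (hφ j) z x ((r - h : ℝ) : 𝕜)
  set a := inclusionInDoubleDual 𝕜 X x + ((r - h : ℝ) : 𝕜) • z with ha
  obtain ⟨y, hy, hyf⟩ := exists_norm_le_one_norm_apply_sub_le hz
    (∑ j ∈ Finset.range (k + 1), f j) h0
  have hrh : ‖((r - h : ℝ) : 𝕜)‖ = r - h := by
    rw [RCLike.norm_ofReal, abs_of_nonneg (by linarith)]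
  have hh : ‖(h : 𝕜)‖ = h := by rw [RCLike.norm_ofReal, abs_of_pos h0]
  have ha1 : ‖a‖ ≤ 1 := by
    refine (norm_add_le _ _).trans ?_
    rw [norm_smul, hrh]
    have := norm_inclusionInDoubleDual_le (𝕜 := 𝕜) x
    have : (r - h) * ‖z‖ ≤ r - h := mul_le_of_le_one_right (by linarith) hz
    linarith
  refine ⟨x + (h : 𝕜) • y, ?_, ?_⟩
  · refine (norm_add_le _ _).trans ?_
    rw [norm_smul, hh]
    have : h * ‖y‖ ≤ h := mul_le_of_le_one_right h0.le hy
    linarith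
  have e1 : inclusionInDoubleDual 𝕜 X x + (r : 𝕜) • z = a + (h : 𝕜) • z := by
    rw [ha, add_assoc, ← add_smul]
    congr 2
    push_cast
    ring
  have e2 : inclusionInDoubleDual 𝕜 X (x + (h : 𝕜) • y) + ((r - h : ℝ) : 𝕜) • z =
      a + (h : 𝕜) • inclusionInDoubleDual 𝕜 X y := by
    rw [ha, map_add, map_smul]
    abel
  have hfz : ∀ j, ∑ i, arensForm 𝕜 X j (φ j) (Function.update (fun _ => a) i z) = z (f j) := by
    intro j
    simpa using hf j 0 1
  have hfy : ∀ j, ∑ i, arensForm 𝕜 X j (φ j)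
      (Function.update (fun _ => a) i (inclusionInDoubleDual 𝕜 X y)) = f j y := by
    intro j
    simpa using hf j y 0
  rw [e1, e2]
  have key : ∀ j, ‖arensForm 𝕜 X j (φ j) (fun _ => a + (h : 𝕜) • z) -
      arensForm 𝕜 X j (φ j) (fun _ => a + (h : 𝕜) • inclusionInDoubleDual 𝕜 X y) -
        (h : 𝕜) * (z (f j) - f j y)‖ ≤ 2 * (2 ^ j * ‖arensForm 𝕜 X j (φ j)‖) * h ^ 2 := by
    intro j
    have k1 := norm_map_add_smul_sub_le (arensForm 𝕜 X j (φ j)) ha1 hz h0.le (hr.trans hr1)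
    have k2 := norm_map_add_smul_sub_le (arensForm 𝕜 X j (φ j)) ha1
      ((norm_inclusionInDoubleDual_le (𝕜 := 𝕜) y).trans hy) h0.le (hr.trans hr1)
    rw [hfz] at k1
    rw [hfy] at k2
    have k3 := norm_sub_le_of_le k1 k2
    refine le_trans (le_of_eq (congrArg _ ?_)) (k3.trans (le_of_eq ?_)) <;> ring
  have hsum : ∑ j ∈ Finset.range (k + 1), arensForm 𝕜 X j (φ j) (fun _ => a + (h : 𝕜) • z) -
      ∑ j ∈ Finset.range (k + 1), arensForm 𝕜 X j (φ j)
        (fun _ => a + (h : 𝕜) • inclusionInDoubleDual 𝕜 X y) =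
      ∑ j ∈ Finset.range (k + 1), (arensForm 𝕜 X j (φ j) (fun _ => a + (h : 𝕜) • z) -
        arensForm 𝕜 X j (φ j) (fun _ => a + (h : 𝕜) • inclusionInDoubleDual 𝕜 X y) -
        (h : 𝕜) * (z (f j) - f j y)) + (h : 𝕜) *
          (z (∑ j ∈ Finset.range (k + 1), f j) - (∑ j ∈ Finset.range (k + 1), f j) y) := by
    simp only [Finset.sum_sub_distrib, ← Finset.mul_sum, map_sum, sum_apply]
    ring
  rw [hsum]
  refine (norm_add_le_of_le (norm_sum_le_of_le _ fun j _ => key j) (r₂ := h * h) ?_).trans ?_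
  · rw [norm_mul, hh]
    exact mul_le_mul_of_nonneg_left hyf h0.le
  · rw [← Finset.sum_mul, ← Finset.mul_sum]
    exact le_of_eq (by ring)

/-- The point `z` is moved to a point of `X` in `n` steps of size `1 / n`, with a total error of order
`1 / n`. -/
theorem norm_sum_arensForm_le (k : ℕ) {φ : (j : ℕ) → X [×j]→L[𝕜] 𝕜}
    (hφ : ∀ (j : ℕ) (σ : Equiv.Perm (Fin j)) (v : Fin j → X), φ j (v ∘ σ) = φ j v) {M : ℝ}
    (hM : ∀ x : X, ‖x‖ ≤ 1 → ‖∑ j ∈ Finset.range (k + 1), φ j (fun _ => x)‖ ≤ M)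
    {z : StrongDual 𝕜 (StrongDual 𝕜 X)} (hz : ‖z‖ ≤ 1) :
    ‖∑ j ∈ Finset.range (k + 1), arensForm 𝕜 X j (φ j) (fun _ => z)‖ ≤ M := by
  set C := 1 + 2 * ∑ j ∈ Finset.range (k + 1), 2 ^ j * ‖arensForm 𝕜 X j (φ j)‖ with hC
  have hC0 : 0 ≤ C := by positivity
  set A : StrongDual 𝕜 (StrongDual 𝕜 X) → 𝕜 := fun v =>
    ∑ j ∈ Finset.range (k + 1), arensForm 𝕜 X j (φ j) (fun _ => v) with hA
  have step : ∀ n : ℕ, 0 < n → ∀ m : ℕ, m ≤ n → ∃ x : X, ‖x‖ ≤ 1 - (1 - m * (1 / n : ℝ)) ∧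
      ‖A z - A (inclusionInDoubleDual 𝕜 X x + ((1 - m * (1 / n : ℝ) : ℝ) : 𝕜) • z)‖ ≤
        m * (C * (1 / n : ℝ) ^ 2) := by
    intro n hn m
    have hn' : (0 : ℝ) < n := by exact_mod_cast hn
    induction m with
    | zero => exact fun _ => ⟨0, by simp, by simp⟩
    | succ m ih =>
      intro hm
      obtain ⟨x, hx, hx'⟩ := ih (by omega)
      have hm' : ((m : ℝ) + 1) * (1 / n) ≤ 1 := by
        rw [mul_one_div, div_le_one hn']
        exact_mod_cast hm
      obtain ⟨x', h1, h2⟩ := exists_norm_sum_arensForm_sub_le k hφ hz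
        (r := 1 - m * (1 / n : ℝ)) (h := 1 / n) (by positivity) (by linarith)
        (by linarith [show 0 ≤ (m : ℝ) * (1 / n) by positivity]) hx
      have e : 1 - (m : ℝ) * (1 / n) - 1 / n = 1 - ((m + 1 : ℕ) : ℝ) * (1 / n) := by
        push_cast
        ring
      rw [e] at h1 h2
      refine ⟨x', h1, (norm_sub_le_norm_sub_add_norm_sub _ _ _).trans ((add_le_add hx' h2).trans
        (le_of_eq ?_))⟩
      push_cast
      ring
  refine le_of_forall_pos_le_add fun ε hε => ?_
  obtain ⟨n, hn⟩ := exists_nat_gt (C / ε)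
  have hn0 : 0 < (n : ℝ) := lt_of_le_of_lt (by positivity) hn
  obtain ⟨x, hx, hx'⟩ := step n (by exact_mod_cast hn0) n le_rfl
  have e : (n : ℝ) * (1 / n) = 1 := by field_simp
  rw [e, sub_self] at hx hx'
  simp only [RCLike.ofReal_zero, zero_smul, add_zero, sub_zero] at hx hx'
  have e2 : A (inclusionInDoubleDual 𝕜 X x) = ∑ j ∈ Finset.range (k + 1), φ j (fun _ => x) :=
    Finset.sum_congr rfl fun j _ => arensForm_inclusionInDoubleDual (φ j) fun _ => x
  have e3 : (n : ℝ) * (C * (1 / n) ^ 2) ≤ ε := by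
    rw [div_lt_iff₀ hε] at hn
    have : (n : ℝ) * (C * (1 / n) ^ 2) = C / n := by field_simp
    rw [this, div_le_iff₀ hn0]
    linarith
  have e4 : ‖A z‖ ≤ ‖A (inclusionInDoubleDual 𝕜 X x)‖ +
      ‖A z - A (inclusionInDoubleDual 𝕜 X x)‖ := by
    have := norm_add_le (A (inclusionInDoubleDual 𝕜 X x)) (A z - A (inclusionInDoubleDual 𝕜 X x))
    rwa [add_sub_cancel] at this
  rw [e2] at e4 hx'
  exact e4.trans (add_le_add (hM x hx) (hx'.trans e3))

/-- Davie–Gamelin: the extension of a polynomial to the bidual does not increase the norm. -/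
theorem ContPoly.norm_aronBerner_apply_le {k : ℕ} {W : Type*} [NormedAddCommGroup W]
    [NormedSpace 𝕜 W] (P : ContPoly 𝕜 k X W) {z : StrongDual 𝕜 (StrongDual 𝕜 X)} (hz : ‖z‖ ≤ 1) :
    ‖P.aronBerner z‖ ≤ ‖P‖ := by
  refine ContinuousLinearMap.opNorm_le_bound _ (norm_nonneg _) fun w => ?_
  rw [P.aronBerner_apply P.symmPart_spec, sum_apply]
  simp only [arens_apply]
  refine norm_sum_arensForm_le k
    (φ := fun j => w.compContinuousMultilinearMap (P.symmPart j)) (fun j σ v => ?_)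
    (fun x hx => ?_) hz
  · simp [P.symmPart_spec.1 j σ v]
  · have : ∑ j ∈ Finset.range (k + 1), w.compContinuousMultilinearMap (P.symmPart j) (fun _ => x) =
        w (P x) := by
      rw [P.symmPart_spec.2 x, map_sum]
      rfl
    rw [this, mul_comm]
    exact w.le_opNorm_of_le (P.norm_apply_le hx)

theorem ContPoly.norm_aronBerner_le {k : ℕ} {W : Type*} [NormedAddCommGroup W]
    [NormedSpace 𝕜 W] (P : ContPoly 𝕜 k X W) : ‖P.aronBerner‖ ≤ ‖P‖ := by
  have : Nonempty (closedBall (0 : StrongDual 𝕜 (StrongDual 𝕜 X)) 1) := ⟨⟨0, by simp⟩⟩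
  exact ciSup_le fun z => P.norm_aronBerner_apply_le (mem_closedBall_zero_iff.mp z.2)

end DavieGamelin

/-! ### The Bishop–Phelps theorem for a closed bounded convex set -/

section BishopPhelps

/-- Ekeland's variational principle for a continuous function bounded above on a closed set. -/
theorem exists_forall_sub_le_mul_norm_sub {E : Type*} [NormedAddCommGroup E] [CompleteSpace E]
    {C : Set E} (hne : C.Nonempty) (hcl : IsClosed C) {p : E → ℝ} (hp : Continuous p) {b : ℝ}
    (hb : ∀ v ∈ C, p v ≤ b) {ε : ℝ} (hε : 0 < ε) :
    ∃ u ∈ C, ∀ v ∈ C, p v - p u ≤ ε * ‖v - u‖ := by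
  have hnext : ∀ (n : ℕ) (u : C), ∃ v : C, ε * ‖(v : E) - u‖ ≤ p v - p u ∧
      ∀ w ∈ C, ε * ‖w - u‖ ≤ p w - p u → p w ≤ p v + 1 / ((n : ℝ) + 1) := by
    intro n u
    set S : Set ℝ := {t | ∃ w ∈ C, ε * ‖w - u‖ ≤ p w - p u ∧ p w = t} with hS
    have hSb : BddAbove S := ⟨b, by rintro _ ⟨w, hw, _, rfl⟩; exact hb w hw⟩
    have hSne : S.Nonempty := ⟨p u, u, u.2, by simp, rfl⟩
    obtain ⟨_, ⟨v, hv, hvu, rfl⟩, hlt⟩ := exists_lt_of_lt_csSup hSne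
      (sub_lt_self (sSup S) (show (0 : ℝ) < 1 / ((n : ℝ) + 1) by positivity))
    refine ⟨⟨v, hv⟩, hvu, fun w hw hwu => ?_⟩
    have := le_csSup hSb ⟨w, hw, hwu, rfl⟩
    simp only
    linarith
  choose next hnext1 hnext2 using hnext
  obtain ⟨v₀, hv₀⟩ := hne
  set u : ℕ → C := fun n => Nat.rec ⟨v₀, hv₀⟩ (fun n v => next n v) n with hu
  have hsucc : ∀ n, u (n + 1) = next n (u n) := fun n => rfl
  have hle : ∀ n m, n ≤ m → ε * ‖(u m : E) - u n‖ ≤ p (u m) - p (u n) := by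
    intro n m hnm
    induction m, hnm using Nat.le_induction with
    | base => simp
    | succ m _ ih =>
      have h1 := hnext1 m (u m)
      rw [← hsucc] at h1
      have h2 := mul_le_mul_of_nonneg_left
        (norm_sub_le_norm_sub_add_norm_sub (u (m + 1) : E) (u m) (u n)) hε.le
      linarith
  have hmono : Monotone fun n => p (u n) := by
    intro n m hnm
    have := hle n m hnm
    have : 0 ≤ ε * ‖(u m : E) - u n‖ := by positivity
    simp only
    linarith
  have hpc : CauchySeq fun n => p (u n) :=
    (tendsto_atTop_ciSup hmono ⟨b, by rintro _ ⟨n, rfl⟩; exact hb _ (u n).2⟩).cauchySeq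
  have huc : CauchySeq fun n => (u n : E) := by
    rw [Metric.cauchySeq_iff']
    intro δ hδ
    obtain ⟨N, hN⟩ := Metric.cauchySeq_iff'.1 hpc (ε * δ) (by positivity)
    refine ⟨N, fun n hn => ?_⟩
    have h1 := hN n hn
    have h2 := hle N n hn
    rw [Real.dist_eq] at h1
    rw [dist_eq_norm]
    exact lt_of_mul_lt_mul_left ((h2.trans (le_abs_self _)).trans_lt h1) hε.le
  obtain ⟨u₀, hu₀⟩ := cauchySeq_tendsto_of_complete huc
  have hu₀C : u₀ ∈ C := hcl.mem_of_tendsto hu₀ (Eventually.of_forall fun n => (u n).2)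
  have hle₀ : ∀ n, ε * ‖u₀ - u n‖ ≤ p u₀ - p (u n) := by
    intro n
    refine le_of_tendsto_of_tendsto ((hu₀.sub_const _).norm.const_mul ε)
      (((hp.tendsto _).comp hu₀).sub_const _) ?_
    filter_upwards [eventually_ge_atTop n] with m hm using hle n m hm
  refine ⟨u₀, hu₀C, fun v hv => ?_⟩
  by_contra! hlt
  have h1 : ∀ n : ℕ, p v ≤ p u₀ + 1 / ((n : ℝ) + 1) := by
    intro n
    have h2 : ε * ‖v - u n‖ ≤ p v - p (u n) := by
      have := mul_le_mul_of_nonneg_left (norm_sub_le_norm_sub_add_norm_sub v u₀ (u n : E)) hε.le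
      have := hle₀ n
      linarith
    have h3 := hnext2 n (u n) v hv h2
    rw [← hsucc] at h3
    have h4 := hle₀ (n + 1)
    have : 0 ≤ ε * ‖u₀ - u (n + 1)‖ := by positivity
    linarith
  have h5 : p v ≤ p u₀ := by
    refine ge_of_tendsto' (b := p v) (x := atTop)
      (f := fun n : ℕ => p u₀ + 1 / ((n : ℝ) + 1)) ?_ h1
    simpa using tendsto_one_div_add_atTop_nhds_zero_nat.const_add (p u₀)
  have : 0 ≤ ε * ‖v - u₀‖ := by positivity
  linarith

/-- A sandwich theorem: if `q (v - u)` is at most `ε ‖v - u‖` on the convex set `C`, then on `C` it is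
dominated by `g (v - u)` for a functional `g` of norm at most `ε`. -/
theorem exists_dual_norm_le_of_forall_le_mul_norm {E : Type*} [NormedAddCommGroup E]
    [NormedSpace ℝ E] {C : Set E} (hconv : Convex ℝ C) (q : StrongDual ℝ E) {u : E} (hu : u ∈ C)
    {ε : ℝ} (hε : 0 < ε) (h : ∀ v ∈ C, q v - q u ≤ ε * ‖v - u‖) :
    ∃ g : StrongDual ℝ E, ‖g‖ ≤ ε ∧ ∀ v ∈ C, q v - q u ≤ g v - g u := by
  -- The strict epigraph of `ε ‖·‖` is separated from the hypograph of `q` on the translate of `C`.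
  set A : Set (E × ℝ) := {a | ε * ‖a.1‖ < a.2} with hA
  set B : Set (E × ℝ) := {a | u + a.1 ∈ C ∧ a.2 ≤ q a.1} with hB
  have hAo : IsOpen A := isOpen_lt (by fun_prop) (by fun_prop)
  have hAc : Convex ℝ A := by
    have h1 : ConvexOn ℝ univ fun v : E => ε * ‖v‖ := convexOn_univ_norm.smul hε.le
    have h2 := h1.convex_strict_epigraph
    simpa [hA] using h2
  have hBc : Convex ℝ B := by
    rintro ⟨v, s⟩ ⟨hv, hs⟩ ⟨w, t⟩ ⟨hw, ht⟩ a b ha hb hab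
    refine ⟨?_, ?_⟩
    · have := hconv hv hw ha hb hab
      simp only [smul_add] at this
      have e : u + (a • v + b • w) = a • u + a • v + (b • u + b • w) := by
        nth_rewrite 1 [← one_smul ℝ u]
        rw [← hab, add_smul]
        abel
      simpa [e] using this
    · simp only [Prod.smul_mk, Prod.mk_add_mk, map_add, map_smul, smul_eq_mul] at hs ht ⊢
      exact add_le_add (mul_le_mul_of_nonneg_left hs ha) (mul_le_mul_of_nonneg_left ht hb)
  have hdisj : Disjoint A B := by
    rw [Set.disjoint_left]
    rintro ⟨v, t⟩ (h1 : ε * ‖v‖ < t) ⟨h2, h3⟩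
    have h4 := h _ h2
    simp only [map_add, add_sub_cancel_left] at h4 h3
    linarith
  obtain ⟨F, s, hFA, hFB⟩ := geometric_hahn_banach_open hAc hAo hBc hdisj
  have hF : ∀ (v : E) (t : ℝ), F (v, t) = F (v, 0) + t * F (0, 1) := by
    intro v t
    have : ((v, t) : E × ℝ) = (v, 0) + t • (0, 1) := by simp
    rw [this, map_add, map_smul, smul_eq_mul]
  set c := F (0, 1) with hc
  have hs0 : s ≤ 0 := by
    have := hFB 0 ⟨by simpa using hu, by simp⟩
    simpa using this
  have hc0 : c < 0 := (hFA (0, 1) (by simp [hA])).trans_le hs0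
  have hs0' : 0 ≤ s := by
    by_contra! hlt
    have h1 := hFA (0, s / (2 * c)) (by
      simp only [hA, mem_ofPred_eq, norm_zero, mul_zero]
      exact div_pos_of_neg_of_neg hlt (by linarith))
    rw [hF, show ((0 : E), (0 : ℝ)) = 0 from rfl, map_zero, zero_add, div_mul_eq_mul_div,
      mul_div_mul_right _ _ hc0.ne] at h1
    linarith
  have hupper : ∀ v : E, F (v, 0) ≤ -c * (ε * ‖v‖) := by
    intro v
    refine le_of_forall_pos_le_add fun δ hδ => ?_
    have h1 := hFA (v, ε * ‖v‖ + δ / (-c)) (by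
      simp only [hA, mem_ofPred_eq]
      have : 0 < δ / (-c) := div_pos hδ (by linarith)
      linarith)
    rw [hF] at h1
    have h2 : δ / (-c) * c = -δ := by
      rw [div_neg, neg_mul, div_mul_cancel₀ _ hc0.ne]
    nlinarith
  refine ⟨(-c)⁻¹ • F.comp (ContinuousLinearMap.inl ℝ E ℝ), ?_, ?_⟩
  · refine ContinuousLinearMap.opNorm_le_bound _ hε.le fun v => ?_
    have h1 : ∀ v, (-c)⁻¹ * F (v, 0) ≤ ε * ‖v‖ := fun v => by
      rw [inv_mul_le_iff₀ (by linarith)]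
      exact hupper v
    have h2 := h1 (-v)
    have h3 : F (-v, 0) = -F (v, 0) := by
      rw [← map_neg]
      simp
    rw [h3, norm_neg] at h2
    simp only [smul_apply, ContinuousLinearMap.comp_apply,
      ContinuousLinearMap.inl_apply, smul_eq_mul, Real.norm_eq_abs]
    exact abs_le.2 ⟨by linarith, h1 v⟩
  · intro v hv
    have h1 := hFB (v - u, q (v - u)) ⟨by simpa using hv, le_rfl⟩
    rw [hF] at h1
    rw [← map_sub, ← map_sub]
    simp only [smul_apply, ContinuousLinearMap.comp_apply,
      ContinuousLinearMap.inl_apply, smul_eq_mul]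
    rw [le_inv_mul_iff₀ (by linarith)]
    linarith

/-- **Bishop–Phelps**: the functionals whose real part attains its supremum on a nonempty closed
bounded convex set are dense in the dual. -/
theorem exists_dual_norm_sub_le_forall_re_le {𝕜 E : Type*} [RCLike 𝕜] [NormedAddCommGroup E]
    [NormedSpace 𝕜 E] [NormedSpace ℝ E] [IsScalarTower ℝ 𝕜 E] [CompleteSpace E]
    {C : Set E} (hne : C.Nonempty) (hcl : IsClosed C) (hconv : Convex ℝ C) {R : ℝ}
    (hR : ∀ v ∈ C, ‖v‖ ≤ R) (f : StrongDual 𝕜 E) {ε : ℝ} (hε : 0 < ε) :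
    ∃ g : StrongDual 𝕜 E, ‖g - f‖ ≤ ε ∧
      ∃ u ∈ C, ∀ v ∈ C, RCLike.re (g v) ≤ RCLike.re (g u) := by
  set q : StrongDual ℝ E := RCLike.reCLM.comp (f.restrictScalars ℝ) with hq
  have hqf : ∀ v, q v = RCLike.re (f v) := fun v => rfl
  obtain ⟨u, hu, hmax⟩ := exists_forall_sub_le_mul_norm_sub hne hcl q.continuous
    (b := ‖q‖ * R) (fun v hv => (le_abs_self _).trans (q.le_opNorm_of_le (hR v hv))) hε
  obtain ⟨g, hg, hgC⟩ := exists_dual_norm_le_of_forall_le_mul_norm hconv q hu hε hmax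
  refine ⟨f - StrongDual.extendRCLike g, ?_, u, hu, fun v hv => ?_⟩
  · rw [sub_sub_cancel_left, norm_neg, StrongDual.norm_extendRCLike]
    exact hg
  · have := hgC v hv
    simp only [sub_apply, map_sub, StrongDual.re_extendRCLike_apply, ← hqf]
    linarith

end BishopPhelps

/-! ### A predual of the space of continuous multilinear maps -/

section Predual

variable {𝕜 X Y : Type*} [RCLike 𝕜] [NormedAddCommGroup X] [NormedSpace 𝕜 X]
  [NormedAddCommGroup Y] [NormedSpace 𝕜 Y] {n : ℕ}

/-- The projective norm `‖x₁‖ ⋯ ‖x_n‖ ‖y‖` of an elementary tensor. -/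
noncomputable def tensorWeight (d : (Fin n → X) × Y) : ℝ := (∏ i, ‖d.1 i‖) * ‖d.2‖

theorem tensorWeight_nonneg (d : (Fin n → X) × Y) : 0 ≤ tensorWeight d := by
  unfold tensorWeight; positivity

theorem norm_apply_apply_le_tensorWeight (Φ : X [×n]→L[𝕜] StrongDual 𝕜 Y)
    (d : (Fin n → X) × Y) : ‖Φ d.1 d.2‖ ≤ ‖Φ‖ * tensorWeight d := by
  rw [tensorWeight, ← mul_assoc]
  exact (Φ d.1).le_of_opNorm_le (Φ.le_opNorm d.1) d.2

/-- The value of `Φ` at the normalization of the elementary tensor `d`, which is `0` if one of its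
factors vanishes. -/
noncomputable def tensorCoeff (Φ : X [×n]→L[𝕜] StrongDual 𝕜 Y) (d : (Fin n → X) × Y) : 𝕜 :=
  ((tensorWeight d : ℝ) : 𝕜)⁻¹ * Φ d.1 d.2

theorem tensorWeight_mul_tensorCoeff (Φ : X [×n]→L[𝕜] StrongDual 𝕜 Y) (d : (Fin n → X) × Y) :
    ((tensorWeight d : ℝ) : 𝕜) * tensorCoeff Φ d = Φ d.1 d.2 := by
  by_cases hd : tensorWeight d = 0
  · have := norm_apply_apply_le_tensorWeight Φ d
    rw [hd, mul_zero, norm_le_zero_iff] at this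
    simp [tensorCoeff, this]
  · rw [tensorCoeff, mul_inv_cancel_left₀ (by exact_mod_cast hd)]

theorem norm_tensorCoeff_le (Φ : X [×n]→L[𝕜] StrongDual 𝕜 Y) (d : (Fin n → X) × Y) :
    ‖tensorCoeff Φ d‖ ≤ ‖Φ‖ := by
  rw [tensorCoeff, norm_mul, norm_inv, RCLike.norm_ofReal, abs_of_nonneg (tensorWeight_nonneg d)]
  rcases (tensorWeight_nonneg d).eq_or_lt with hd | hd
  · rw [← hd]
    simp
  · rw [inv_mul_le_iff₀ hd, mul_comm]
    exact norm_apply_apply_le_tensorWeight Φ d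

/-- A multilinear map as a functional on the `ℓ¹` space over all elementary tensors. -/
noncomputable def l1Pairing (Φ : X [×n]→L[𝕜] StrongDual 𝕜 Y) :
    lp (fun _ : (Fin n → X) × Y => 𝕜) 1 →L[𝕜] 𝕜 :=
  lp.tsumCLM 𝕜 ((Fin n → X) × Y) 𝕜 ∘L
    lp.mapCLM 1 (fun d => tensorCoeff Φ d • ContinuousLinearMap.id 𝕜 𝕜) (norm_nonneg Φ)
      (fun d => by
        rw [norm_smul, ContinuousLinearMap.norm_id, mul_one]
        exact norm_tensorCoeff_le Φ d)

theorem l1Pairing_apply (Φ : X [×n]→L[𝕜] StrongDual 𝕜 Y)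
    (c : lp (fun _ : (Fin n → X) × Y => 𝕜) 1) :
    l1Pairing Φ c = ∑' d, tensorCoeff Φ d * c d := by
  simp [l1Pairing]

theorem l1Pairing_single [DecidableEq ((Fin n → X) × Y)] (Φ : X [×n]→L[𝕜] StrongDual 𝕜 Y)
    (d : (Fin n → X) × Y) (a : 𝕜) : l1Pairing Φ (lp.single 1 d a) = tensorCoeff Φ d * a := by
  rw [l1Pairing_apply, tsum_eq_single d]
  · simp
  · intro d' hd'
    simp [hd']

variable (𝕜 X Y n) in
/-- The summable families of elementary tensors on which all multilinear maps vanish. -/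
noncomputable def tensorRelations : Submodule 𝕜 (lp (fun _ : (Fin n → X) × Y => 𝕜) 1) :=
  ⨅ Φ : X [×n]→L[𝕜] StrongDual 𝕜 Y, (l1Pairing Φ).ker

instance isClosed_tensorRelations :
    IsClosed (tensorRelations 𝕜 X Y n : Set (lp (fun _ : (Fin n → X) × Y => 𝕜) 1)) := by
  rw [tensorRelations, Submodule.coe_iInf]
  exact isClosed_iInter fun Φ => (l1Pairing Φ).isClosed_ker

variable (𝕜 X Y n) in
/-- The completed projective tensor product `X ⊗ ⋯ ⊗ X ⊗ Y`, a predual of the space of continuous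
`n`-linear maps from `X` to `Y'`. It is encoded as a quotient of the `ℓ¹` space over all elementary
tensors, so that its elements are represented by absolutely convergent series by construction. -/
def TensorPredual : Type _ :=
  lp (fun _ : (Fin n → X) × Y => 𝕜) 1 ⧸ tensorRelations 𝕜 X Y n

namespace TensorPredual

noncomputable instance : NormedAddCommGroup (TensorPredual 𝕜 X Y n) :=
  inferInstanceAs (NormedAddCommGroup
    (lp (fun _ : (Fin n → X) × Y => 𝕜) 1 ⧸ tensorRelations 𝕜 X Y n))

noncomputable instance : NormedSpace 𝕜 (TensorPredual 𝕜 X Y n) :=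
  inferInstanceAs (NormedSpace 𝕜
    (lp (fun _ : (Fin n → X) × Y => 𝕜) 1 ⧸ tensorRelations 𝕜 X Y n))

noncomputable instance : NormedSpace ℝ (TensorPredual 𝕜 X Y n) :=
  NormedSpace.restrictScalars ℝ 𝕜 _

instance : IsScalarTower ℝ 𝕜 (TensorPredual 𝕜 X Y n) :=
  RestrictScalars.isScalarTower ℝ 𝕜 (TensorPredual 𝕜 X Y n)

instance : CompleteSpace (TensorPredual 𝕜 X Y n) :=
  inferInstanceAs (CompleteSpace
    (lp (fun _ : (Fin n → X) × Y => 𝕜) 1 ⧸ tensorRelations 𝕜 X Y n))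

variable (𝕜 X Y n) in
/-- The quotient map. -/
noncomputable def mkL : lp (fun _ : (Fin n → X) × Y => 𝕜) 1 →L[𝕜] TensorPredual 𝕜 X Y n :=
  (tensorRelations 𝕜 X Y n).mkQL

theorem mkL_surjective : Function.Surjective (mkL 𝕜 X Y n) := Submodule.Quotient.mk_surjective _

theorem mkL_eq_mkL_iff {c c' : lp (fun _ : (Fin n → X) × Y => 𝕜) 1} :
    mkL 𝕜 X Y n c = mkL 𝕜 X Y n c' ↔ c - c' ∈ tensorRelations 𝕜 X Y n :=
  Submodule.Quotient.eq _

/-- The functional on the predual given by a multilinear map. -/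
noncomputable def pairing (Φ : X [×n]→L[𝕜] StrongDual 𝕜 Y) : StrongDual 𝕜 (TensorPredual 𝕜 X Y n) :=
  (tensorRelations 𝕜 X Y n).liftQL (l1Pairing Φ) (iInf_le _ Φ)

theorem pairing_mkL (Φ : X [×n]→L[𝕜] StrongDual 𝕜 Y)
    (c : lp (fun _ : (Fin n → X) × Y => 𝕜) 1) :
    pairing Φ (mkL 𝕜 X Y n c) = l1Pairing Φ c := rfl

theorem eq_of_forall_pairing_eq {u v : TensorPredual 𝕜 X Y n}
    (h : ∀ Φ : X [×n]→L[𝕜] StrongDual 𝕜 Y, pairing Φ u = pairing Φ v) : u = v := by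
  obtain ⟨c, rfl⟩ := mkL_surjective u
  obtain ⟨c', rfl⟩ := mkL_surjective v
  rw [mkL_eq_mkL_iff, tensorRelations, Submodule.mem_iInf]
  intro Φ
  have : l1Pairing Φ c = l1Pairing Φ c' := h Φ
  simp [this]

theorem exists_pairing_eq_tsum (u : TensorPredual 𝕜 X Y n) :
    ∃ c : lp (fun _ : (Fin n → X) × Y => 𝕜) 1, ∀ Φ : X [×n]→L[𝕜] StrongDual 𝕜 Y,
      pairing Φ u = ∑' d, tensorCoeff Φ d * c d := by
  obtain ⟨c, rfl⟩ := mkL_surjective u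
  exact ⟨c, fun Φ => l1Pairing_apply Φ c⟩

open Classical in
/-- The elementary tensor `x₁ ⊗ ⋯ ⊗ x_n ⊗ y`. -/
noncomputable def tmul (x : Fin n → X) (y : Y) : TensorPredual 𝕜 X Y n :=
  mkL 𝕜 X Y n (lp.single 1 (x, y) ((tensorWeight (x, y) : ℝ) : 𝕜))

theorem pairing_tmul (Φ : X [×n]→L[𝕜] StrongDual 𝕜 Y) (x : Fin n → X) (y : Y) :
    pairing Φ (tmul x y) = Φ x y := by
  classical
  rw [tmul, pairing_mkL, l1Pairing_single, mul_comm, tensorWeight_mul_tensorCoeff]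

theorem norm_tmul_le (x : Fin n → X) (y : Y) :
    ‖(tmul x y : TensorPredual 𝕜 X Y n)‖ ≤ (∏ i, ‖x i‖) * ‖y‖ := by
  classical
  refine (Submodule.Quotient.norm_mk_le _ _).trans ?_
  rw [lp.norm_single (by simp), RCLike.norm_ofReal, abs_of_nonneg (tensorWeight_nonneg _)]
  rfl

theorem norm_apply_tmul_le (L : StrongDual 𝕜 (TensorPredual 𝕜 X Y n)) (x : Fin n → X) (y : Y) :
    ‖L (tmul x y)‖ ≤ ‖L‖ * (∏ i, ‖x i‖) * ‖y‖ := by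
  rw [mul_assoc]
  exact L.le_opNorm_of_le (norm_tmul_le x y)

/-- The multilinear map represented by a functional on the predual. -/
noncomputable def toMultilinear (L : StrongDual 𝕜 (TensorPredual 𝕜 X Y n)) :
    X [×n]→L[𝕜] StrongDual 𝕜 Y :=
  MultilinearMap.mkContinuous
    { toFun := fun x => LinearMap.mkContinuous
        { toFun := fun y => L (tmul x y)
          map_add' := fun y y' => by
            rw [← map_add]
            congr 1
            exact eq_of_forall_pairing_eq fun Φ => by simp only [map_add, pairing_tmul]
          map_smul' := fun c y => by
            rw [RingHom.id_apply, ← map_smul]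
            congr 1
            exact eq_of_forall_pairing_eq fun Φ => by simp only [map_smul, pairing_tmul] }
        (‖L‖ * ∏ i, ‖x i‖) (norm_apply_tmul_le L x)
      map_update_add' := fun x i a b => by
        ext y
        change L _ = L _ + L _
        rw [← map_add]
        congr 1
        exact eq_of_forall_pairing_eq fun Φ => by
          simp only [map_add, pairing_tmul, ContinuousMultilinearMap.map_update_add, add_apply]
      map_update_smul' := fun x i c a => by
        ext y
        change L _ = c • L _
        rw [← map_smul]
        congr 1
        exact eq_of_forall_pairing_eq fun Φ => by
          simp only [map_smul, pairing_tmul, ContinuousMultilinearMap.map_update_smul,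
            smul_apply] }
    ‖L‖ fun x => LinearMap.mkContinuous_norm_le _ (by positivity) (norm_apply_tmul_le L x)

theorem toMultilinear_apply (L : StrongDual 𝕜 (TensorPredual 𝕜 X Y n)) (x : Fin n → X) (y : Y) :
    toMultilinear L x y = L (tmul x y) := rfl

theorem pairing_toMultilinear (L : StrongDual 𝕜 (TensorPredual 𝕜 X Y n)) :
    pairing (toMultilinear L) = L := by
  classical
  ext u
  obtain ⟨c, rfl⟩ := mkL_surjective u
  have hsingle : ∀ (d : (Fin n → X) × Y) (a : 𝕜),
      pairing (toMultilinear L) (mkL 𝕜 X Y n (lp.single 1 d a)) =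
        L (mkL 𝕜 X Y n (lp.single 1 d a)) := by
    intro d a
    have h1 : mkL 𝕜 X Y n (lp.single 1 d a) =
        (((tensorWeight d : ℝ) : 𝕜)⁻¹ * a) • tmul d.1 d.2 := by
      refine eq_of_forall_pairing_eq fun Φ => ?_
      rw [pairing_mkL, l1Pairing_single, map_smul, pairing_tmul, tensorCoeff, smul_eq_mul]
      ring
    rw [h1, map_smul, map_smul, pairing_tmul, toMultilinear_apply]
  have hsum := lp.hasSum_single (p := 1) (by simp) c
  have h1 := ((pairing (toMultilinear L)).comp (mkL 𝕜 X Y n)).hasSum hsum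
  have h2 := (L.comp (mkL 𝕜 X Y n)).hasSum hsum
  simp only [ContinuousLinearMap.comp_apply, hsingle] at h1 h2
  exact h1.unique h2

end TensorPredual

end Predual

/-! ### Measures representing points of a closed convex hull -/

section Barycenter

/-- A point of the closed convex hull of a family `e` is represented by a probability measure on a
compact space `K` in which the index set is placed by `J`: every functional whose values on the
family extend continuously to `K` is given at the point by integration. -/
theorem exists_probabilityMeasure_of_mem_closure_convexHull {𝕜 E K ι : Type*} [RCLike 𝕜]
    [NormedAddCommGroup E] [NormedSpace 𝕜 E] [NormedSpace ℝ E] [IsScalarTower ℝ 𝕜 E]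
    [TopologicalSpace K] [CompactSpace K] [T2Space K] [MeasurableSpace K] [BorelSpace K]
    (e : ι → E) (J : ι → K) {v : E} (hv : v ∈ closure (convexHull ℝ (range e))) :
    ∃ μ : ProbabilityMeasure K, ∀ (L : StrongDual 𝕜 E) (h : C(K, 𝕜)),
      (∀ i, h (J i) = L (e i)) → L v = ∫ p, h p ∂(μ : Measure K) := by
  have hint : ∀ (μ : Measure K) [IsFiniteMeasure μ] (h : C(K, 𝕜)), Integrable h μ :=
    fun μ _ h => (BoundedContinuousFunction.mkOfCompact h).integrable μ
  set S : Set (E × ProbabilityMeasure K) := {a | ∀ (L : StrongDual 𝕜 E) (h : C(K, 𝕜)),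
    (∀ i, h (J i) = L (e i)) → L a.1 = ∫ p, h p ∂(a.2 : Measure K)} with hS
  have hScl : IsClosed S := by
    simp only [hS, Set.ofPred_forall]
    refine isClosed_iInter fun L => isClosed_iInter fun h => isClosed_iInter fun _ =>
      isClosed_eq (L.continuous.comp continuous_fst) ?_
    have h1 : Continuous fun μ : ProbabilityMeasure K => ∫ p, h p ∂(μ : Measure K) :=
      continuous_iff_continuousAt.2 fun μ =>
        (ProbabilityMeasure.tendsto_iff_forall_integral_rclike_tendsto 𝕜).1 tendsto_id
          (BoundedContinuousFunction.mkOfCompact h)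
    exact h1.comp continuous_snd
  have hcl : IsClosed (Prod.fst '' S) := isClosedMap_fst_of_compactSpace _ hScl
  have hconv : Convex ℝ (Prod.fst '' S) := by
    rintro _ ⟨⟨v, μ⟩, hμ, rfl⟩ _ ⟨⟨w, ν⟩, hν, rfl⟩ a b ha hb hab
    have hprob : IsProbabilityMeasure
        (ENNReal.ofReal a • (μ : Measure K) + ENNReal.ofReal b • (ν : Measure K)) := by
      constructor
      simp only [Measure.add_apply, Measure.smul_apply, measure_univ, smul_eq_mul, mul_one]
      rw [← ENNReal.ofReal_add ha hb, hab, ENNReal.ofReal_one]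
    refine ⟨(a • v + b • w, ⟨_, hprob⟩), fun L h hL => ?_, rfl⟩
    have h1 := hμ L h hL
    have h2 := hν L h hL
    simp only at h1 h2
    change L (a • v + b • w) = ∫ p, h p ∂(ENNReal.ofReal a • (μ : Measure K) +
      ENNReal.ofReal b • (ν : Measure K))
    rw [integral_add_measure ((hint _ h).smul_measure ENNReal.ofReal_ne_top)
      ((hint _ h).smul_measure ENNReal.ofReal_ne_top), integral_smul_measure,
      integral_smul_measure, ENNReal.toReal_ofReal ha, ENNReal.toReal_ofReal hb, ← h1, ← h2,
      map_add]
    congr 1 <;> exact ContinuousLinearMap.map_smul_of_tower L _ _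
  have hrange : range e ⊆ Prod.fst '' S := by
    rintro _ ⟨i, rfl⟩
    refine ⟨(e i, ⟨Measure.dirac (J i), inferInstance⟩), fun L h hL => ?_, rfl⟩
    change L (e i) = ∫ p, h p ∂(Measure.dirac (J i))
    rw [integral_dirac, hL]
  obtain ⟨⟨w, μ⟩, hμ, rfl⟩ := closure_minimal (convexHull_min hrange hconv) hcl hv
  exact ⟨μ, hμ⟩

theorem integral_sum_smul_dirac_of_norm_le {D F : Type*} [MeasurableSpace D]
    [DiscreteMeasurableSpace D] [NormedAddCommGroup F] [NormedSpace ℝ F] [CompleteSpace F]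
    [SecondCountableTopology F] {a : D → ℝ≥0∞}
    [IsFiniteMeasure (Measure.sum fun d => a d • Measure.dirac d)]
    {f : D → F} {B : ℝ} (hB : ∀ d, ‖f d‖ ≤ B) :
    ∫ d, f d ∂(Measure.sum fun d => a d • Measure.dirac d) = ∑' d, (a d).toReal • f d := by
  borelize F
  have hf : Integrable f (Measure.sum fun d => a d • Measure.dirac d) :=
    integrable_of_measurable_of_norm_le (Measurable.of_discrete).stronglyMeasurable hB
  rw [← (hasSum_integral_measure hf).tsum_eq]
  congr 1 with d
  rw [integral_smul_measure, integral_dirac]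

end Barycenter

/-! ### The integral formula -/

section IntegralFormula

variable {𝕜 X V : Type*} [RCLike 𝕜] [NormedAddCommGroup X] [NormedSpace 𝕜 X]
  [NormedAddCommGroup V] [NormedSpace 𝕜 V]

theorem measurable_prod_mul {Ω : Type*} [MeasurableSpace Ω] {n : ℕ}
    {Z : Fin n → Ω → StrongDual 𝕜 (StrongDual 𝕜 X)} (hZ : ∀ a f, Measurable fun ω => Z a ω f)
    {W : Ω → StrongDual 𝕜 V} (hW : ∀ v, Measurable fun ω => W ω v)
    (f : Fin n → StrongDual 𝕜 X) (v : V) :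
    Measurable fun ω => (∏ a, Z a ω (f a)) * W ω v :=
  (Finset.measurable_prod _ fun a _ => hZ a (f a)).mul (hW v)

theorem norm_prod_mul_le {n : ℕ}
    {z : Fin n → StrongDual 𝕜 (StrongDual 𝕜 X)} (hz : ∀ a, ‖z a‖ ≤ 1)
    {w : StrongDual 𝕜 V} (hw : ‖w‖ ≤ 1)
    (f : Fin n → StrongDual 𝕜 X) (v : V) :
    ‖(∏ a, z a (f a)) * w v‖ ≤ (∏ a, ‖f a‖) * ‖v‖ := by
  rw [norm_mul, norm_prod]
  gcongr with a
  · simpa using (z a).le_of_opNorm_le (hz a) (f a)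
  · simpa using w.le_of_opNorm_le hw v

theorem norm_arens_apply_le {n : ℕ} (Ψ : X [×n]→L[𝕜] V)
    {z : Fin n → StrongDual 𝕜 (StrongDual 𝕜 X)} (hz : ∀ a, ‖z a‖ ≤ 1)
    {w : StrongDual 𝕜 V} (hw : ‖w‖ ≤ 1) : ‖arens Ψ z w‖ ≤ ‖arens Ψ‖ := by
  have h1 : ‖arens Ψ z‖ ≤ ‖arens Ψ‖ := ((arens Ψ).le_opNorm z).trans
    (mul_le_of_le_one_right (norm_nonneg _) (Finset.prod_le_one (fun _ _ => norm_nonneg _)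
      fun a _ => hz a))
  exact ((arens Ψ z).le_of_opNorm_le h1 w).trans (mul_le_of_le_one_right (norm_nonneg _) hw)

/-- Two systems `(Z₁, …, Z_n, W)` on finite measure spaces with the same integrals of products
`Z₁(f₁) ⋯ Z_n(f_n) W(v)` have the same integrals of the extensions of all multilinear maps. -/
theorem integral_arens_eq_integral_arens
    (hsep : TopologicalSpace.SeparableSpace (StrongDual 𝕜 X))
    (hap : HasApproximationProperty 𝕜 (StrongDual 𝕜 X)) {Ω Ω' : Type*} [MeasurableSpace Ω]
    [MeasurableSpace Ω'] {μ : Measure Ω} [IsFiniteMeasure μ] {μ' : Measure Ω'}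
    [IsFiniteMeasure μ'] {n : ℕ} (Ψ : X [×n]→L[𝕜] V)
    {Z : Fin n → Ω → StrongDual 𝕜 (StrongDual 𝕜 X)} {W : Ω → StrongDual 𝕜 V}
    {Z' : Fin n → Ω' → StrongDual 𝕜 (StrongDual 𝕜 X)} {W' : Ω' → StrongDual 𝕜 V}
    (hZ : ∀ a f, Measurable fun ω => Z a ω f) (hW : ∀ v, Measurable fun ω => W ω v)
    (hZ' : ∀ a f, Measurable fun ω => Z' a ω f) (hW' : ∀ v, Measurable fun ω => W' ω v)
    (hZ1 : ∀ a ω, ‖Z a ω‖ ≤ 1) (hW1 : ∀ ω, ‖W ω‖ ≤ 1)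
    (hZ1' : ∀ a ω, ‖Z' a ω‖ ≤ 1) (hW1' : ∀ ω, ‖W' ω‖ ≤ 1)
    (h : ∀ (f : Fin n → StrongDual 𝕜 X) (v : V),
      ∫ ω, (∏ a, Z a ω (f a)) * W ω v ∂μ = ∫ ω, (∏ a, Z' a ω (f a)) * W' ω v ∂μ') :
    ∫ ω, arens Ψ (fun a => Z a ω) (W ω) ∂μ = ∫ ω, arens Ψ (fun a => Z' a ω) (W' ω) ∂μ' := by
  -- Both systems are placed on the disjoint union; the sign of the second one goes into `U`.
  set ν : Measure (Ω ⊕ Ω') := μ.map Sum.inl + μ'.map Sum.inr with hν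
  have hfin1 : IsFiniteMeasure (μ.map (Sum.inl : Ω → Ω ⊕ Ω')) := Measure.isFiniteMeasure_map _ _
  have hfin2 : IsFiniteMeasure (μ'.map (Sum.inr : Ω' → Ω ⊕ Ω')) := Measure.isFiniteMeasure_map _ _
  set Y : Fin n → Ω ⊕ Ω' → StrongDual 𝕜 (StrongDual 𝕜 X) := fun a => Sum.elim (Z a) (Z' a) with hY
  set U : Ω ⊕ Ω' → StrongDual 𝕜 V := Sum.elim W (fun ω => -W' ω) with hU
  have hYm : ∀ a f, Measurable fun ω => Y a ω f := fun a f =>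
    measurable_fun_sum (hZ a f) (hZ' a f)
  have hUm : ∀ v, Measurable fun ω => U ω v := fun v =>
    measurable_fun_sum (hW v) (hW' v).neg
  have hY1 : ∀ a ω, ‖Y a ω‖ ≤ 1 := by
    rintro a (ω | ω)
    · exact hZ1 a ω
    · exact hZ1' a ω
  have hU1 : ∀ ω, ‖U ω‖ ≤ 1 := by
    rintro (ω | ω)
    · exact hW1 ω
    · exact (norm_neg _).trans_le (hW1' ω)
  have hsplit : ∀ {F : Ω ⊕ Ω' → 𝕜} (B : ℝ), Measurable F → (∀ ω, ‖F ω‖ ≤ B) →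
      ∫ ω, F ω ∂ν = ∫ ω, F (Sum.inl ω) ∂μ + ∫ ω, F (Sum.inr ω) ∂μ' := by
    intro F B hF hB
    rw [hν, integral_add_measure (integrable_of_measurable_of_norm_le hF.stronglyMeasurable hB)
      (integrable_of_measurable_of_norm_le hF.stronglyMeasurable hB),
      integral_map measurable_inl.aemeasurable hF.aestronglyMeasurable,
      integral_map measurable_inr.aemeasurable hF.aestronglyMeasurable]
  have h0 := integral_arens_eq_zero hsep hap (μ := ν) Ψ hYm hUm hY1 hU1 fun f v => by
    rw [hsplit _ (measurable_prod_mul hYm hUm f v)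
      fun ω => norm_prod_mul_le (fun a => hY1 a ω) (hU1 ω) f v]
    simp only [hY, hU, Sum.elim_inl, Sum.elim_inr, neg_apply, mul_neg, integral_neg]
    rw [h, add_neg_cancel]
  rw [hsplit _ (measurable_arens hsep Ψ hYm hUm)
    fun ω => norm_arens_apply_le Ψ (fun a => hY1 a ω) (hU1 ω)] at h0
  simp only [hY, hU, Sum.elim_inl, Sum.elim_inr, map_neg, integral_neg] at h0
  exact add_neg_eq_zero.1 h0

/-- The multilinear map `(x₁, …, x_n) ↦ f₁(x₁) ⋯ f_n(x_n) v`. -/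
noncomputable def prodSmul {n : ℕ} (f : Fin n → StrongDual 𝕜 X) (v : V) : X [×n]→L[𝕜] V :=
  ((ContinuousMultilinearMap.mkPiAlgebra 𝕜 (Fin n) 𝕜).compContinuousLinearMap f).smulRight v

theorem prodSmul_apply {n : ℕ} (f : Fin n → StrongDual 𝕜 X) (v : V) (x : Fin n → X) :
    prodSmul f v x = (∏ i, f i (x i)) • v := by
  simp [prodSmul]

variable {Y : Type*} [NormedAddCommGroup Y] [NormedSpace 𝕜 Y]

open NormedSpace (inclusionInDoubleDual)

theorem arens_smul_inclusionInDoubleDual {n : ℕ} (Φ : X [×n]→L[𝕜] V) (t : Fin n → 𝕜)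
    (x : Fin n → X) (w : StrongDual 𝕜 V) :
    arens Φ (fun a => t a • inclusionInDoubleDual 𝕜 X (x a)) w = (∏ a, t a) * w (Φ x) := by
  rw [(arens Φ).map_smul_univ, smul_apply, arens_inclusionInDoubleDual, smul_eq_mul]

theorem arens_prodSmul_smul_inclusionInDoubleDual {n : ℕ} (f : Fin n → StrongDual 𝕜 X) (v : V)
    (t : Fin n → 𝕜) (x : Fin n → X) (w : StrongDual 𝕜 V) :
    arens (prodSmul f v) (fun a => t a • inclusionInDoubleDual 𝕜 X (x a)) w =
      (∏ a, (t a • inclusionInDoubleDual 𝕜 X (x a)) (f a)) * w v := by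
  rw [arens_smul_inclusionInDoubleDual, prodSmul_apply, map_smul, smul_eq_mul, ← mul_assoc,
    ← Finset.prod_mul_distrib]
  rfl

theorem norm_inv_smul_inclusionInDoubleDual_le {E : Type*} [NormedAddCommGroup E]
    [NormedSpace 𝕜 E] (x : E) : ‖((‖x‖ : 𝕜)⁻¹) • inclusionInDoubleDual 𝕜 E x‖ ≤ 1 := by
  rw [norm_smul, norm_inv, RCLike.norm_ofReal, abs_norm]
  exact (mul_le_mul_of_nonneg_left (norm_inclusionInDoubleDual_le x) (by positivity)).trans
    inv_mul_le_one

/-- If a measure represents an element `u` of the predual on the multilinear maps of finite type,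
it represents `u` on all multilinear maps. -/
theorem TensorPredual.pairing_eq_integral_arens
    (hsep : TopologicalSpace.SeparableSpace (StrongDual 𝕜 X))
    (hap : HasApproximationProperty 𝕜 (StrongDual 𝕜 X)) {Ω : Type*} [MeasurableSpace Ω]
    {μ : Measure Ω} [IsFiniteMeasure μ] {n : ℕ} (u : TensorPredual 𝕜 X Y n)
    {Z : Ω → StrongDual 𝕜 (StrongDual 𝕜 X)} {W : Ω → StrongDual 𝕜 (StrongDual 𝕜 Y)}
    (hZ : ∀ f, Measurable fun ω => Z ω f) (hW : ∀ v, Measurable fun ω => W ω v)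
    (hZ1 : ∀ ω, ‖Z ω‖ ≤ 1) (hW1 : ∀ ω, ‖W ω‖ ≤ 1)
    (h : ∀ (f : Fin n → StrongDual 𝕜 X) (v : StrongDual 𝕜 Y),
      pairing (prodSmul f v) u = ∫ ω, (∏ a, Z ω (f a)) * W ω v ∂μ)
    (Ψ : X [×n]→L[𝕜] StrongDual 𝕜 Y) :
    pairing Ψ u = ∫ ω, arens Ψ (fun _ => Z ω) (W ω) ∂μ := by
  obtain ⟨c, hc⟩ := exists_pairing_eq_tsum u
  let _ : MeasurableSpace ((Fin n → X) × Y) := ⊤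
  have : DiscreteMeasurableSpace ((Fin n → X) × Y) := ⟨fun _ => trivial⟩
  have hcs : Summable fun d => ‖c d‖ := by simpa using (lp.memℓp c).summable (by simp)
  have hfin : IsFiniteMeasure
      (Measure.sum fun d => ENNReal.ofReal ‖c d‖ • Measure.dirac d) := by
    constructor
    simp only [Measure.sum_apply _ MeasurableSet.univ, Measure.smul_apply, measure_univ,
      smul_eq_mul, mul_one]
    exact hcs.tsum_ofReal_lt_top
  -- The series of `u`, as a second system: `Z₀` and `W₀` are the normalized factors of the tensor,
  -- and the phase of its coefficient is absorbed into `W₀`.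
  set Z₀ : Fin n → (Fin n → X) × Y → StrongDual 𝕜 (StrongDual 𝕜 X) := fun a d =>
    ((‖d.1 a‖ : 𝕜)⁻¹) • inclusionInDoubleDual 𝕜 X (d.1 a) with hZ₀
  set W₀ : (Fin n → X) × Y → StrongDual 𝕜 (StrongDual 𝕜 Y) := fun d =>
    (c d / (‖c d‖ : 𝕜)) • (((‖d.2‖ : 𝕜)⁻¹) • inclusionInDoubleDual 𝕜 Y d.2) with hW₀
  have hZ₀1 : ∀ a d, ‖Z₀ a d‖ ≤ 1 := fun a d => norm_inv_smul_inclusionInDoubleDual_le _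
  have hW₀1 : ∀ d, ‖W₀ d‖ ≤ 1 := by
    intro d
    rw [hW₀, norm_smul, norm_div, RCLike.norm_ofReal, abs_norm]
    exact mul_le_one₀ (div_self_le_one _) (norm_nonneg _)
      (norm_inv_smul_inclusionInDoubleDual_le _)
  have hval : ∀ (Φ : X [×n]→L[𝕜] StrongDual 𝕜 Y) (d : (Fin n → X) × Y),
      (ENNReal.ofReal ‖c d‖).toReal • arens Φ (fun a => Z₀ a d) (W₀ d) =
        tensorCoeff Φ d * c d := by
    intro Φ d
    rw [arens_smul_inclusionInDoubleDual, hW₀, smul_apply, smul_apply,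
      ENNReal.toReal_ofReal (norm_nonneg _), NormedSpace.dual_def, tensorCoeff, tensorWeight,
      RCLike.real_smul_eq_coe_mul, Finset.prod_inv_distrib]
    push_cast
    simp only [smul_eq_mul]
    rw [mul_inv]
    have h2 : (‖c d‖ : 𝕜) * (c d / (‖c d‖ : 𝕜)) = c d := by
      by_cases h0 : c d = 0
      · simp [h0]
      · have : (‖c d‖ : 𝕜) ≠ 0 := by simpa using h0
        field_simp
    linear_combination ((∏ a, (‖d.1 a‖ : 𝕜))⁻¹ * (‖d.2‖ : 𝕜)⁻¹ * Φ d.1 d.2) * h2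
  have hpair : ∀ Φ : X [×n]→L[𝕜] StrongDual 𝕜 Y, pairing Φ u =
      ∫ d, arens Φ (fun a => Z₀ a d) (W₀ d)
        ∂(Measure.sum fun d => ENNReal.ofReal ‖c d‖ • Measure.dirac d) := by
    intro Φ
    rw [hc, integral_sum_smul_dirac_of_norm_le
      fun d => norm_arens_apply_le Φ (fun a => hZ₀1 a d) (hW₀1 d)]
    exact tsum_congr fun d => (hval Φ d).symm
  rw [hpair]
  refine integral_arens_eq_integral_arens hsep hap Ψ (Z' := fun _ => Z)
    (fun _ _ => Measurable.of_discrete) (fun _ => Measurable.of_discrete) (fun _ => hZ) hW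
    hZ₀1 hW₀1 (fun _ => hZ1) hW1 fun f v => ?_
  rw [← h, hpair]
  congr 1 with d
  exact (arens_prodSmul_smul_inclusionInDoubleDual f v _ d.1 (W₀ d)).symm

end IntegralFormula

/-! ### Density of the norm attaining extensions -/

section Density

variable {𝕜 X Y : Type*} [RCLike 𝕜] [NormedAddCommGroup X] [NormedSpace 𝕜 X]
  [NormedAddCommGroup Y] [NormedSpace 𝕜 Y] {k : ℕ}

open NormedSpace (inclusionInDoubleDual)

variable (𝕜 k) in
/-- The evaluation at `x` and `y`, as an element of the predual of the tuples of multilinear maps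
of degree at most `k`. -/
noncomputable def polyTensor (x : X) (y : Y) : ∀ j : Fin (k + 1), TensorPredual 𝕜 X Y j :=
  fun _ => TensorPredual.tmul (fun _ => x) y

theorem norm_polyTensor_le {x : X} (hx : ‖x‖ ≤ 1) (y : Y) : ‖polyTensor 𝕜 k x y‖ ≤ ‖y‖ :=
  (pi_norm_le_iff_of_nonneg (norm_nonneg _)).2 fun _ => (TensorPredual.norm_tmul_le _ _).trans
    (mul_le_of_le_one_left (norm_nonneg _)
      (Finset.prod_le_one (fun _ _ => norm_nonneg _) fun _ _ => hx))

variable (k) in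
/-- The functional `u ↦ ∑ⱼ ⟨Φⱼ, uⱼ⟩`. -/
noncomputable def polyPairing (Φ : (j : ℕ) → X [×j]→L[𝕜] StrongDual 𝕜 Y) :
    StrongDual 𝕜 (∀ j : Fin (k + 1), TensorPredual 𝕜 X Y j) :=
  ∑ j : Fin (k + 1), (TensorPredual.pairing (Φ j)).comp (ContinuousLinearMap.proj j)

theorem polyPairing_apply (Φ : (j : ℕ) → X [×j]→L[𝕜] StrongDual 𝕜 Y)
    (u : ∀ j : Fin (k + 1), TensorPredual 𝕜 X Y j) :
    polyPairing k Φ u = ∑ j : Fin (k + 1), TensorPredual.pairing (Φ j) (u j) := by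
  simp [polyPairing]

theorem polyPairing_polyTensor (Φ : (j : ℕ) → X [×j]→L[𝕜] StrongDual 𝕜 Y) (x : X) (y : Y) :
    polyPairing k Φ (polyTensor 𝕜 k x y) =
      (∑ j ∈ Finset.range (k + 1), Φ j (fun _ => x)) y := by
  rw [polyPairing_apply, sum_apply, Finset.sum_range]
  exact Finset.sum_congr rfl fun j _ => TensorPredual.pairing_tmul _ _ _

theorem exists_polyPairing_eq (g : StrongDual 𝕜 (∀ j : Fin (k + 1), TensorPredual 𝕜 X Y j)) :
    ∃ Φ : (j : ℕ) → X [×j]→L[𝕜] StrongDual 𝕜 Y, polyPairing k Φ = g := by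
  refine ⟨fun j => if h : j < k + 1 then TensorPredual.toMultilinear
    (g.comp (ContinuousLinearMap.single 𝕜 (fun j : Fin (k + 1) => TensorPredual 𝕜 X Y j) ⟨j, h⟩))
    else 0, ?_⟩
  ext u
  rw [polyPairing_apply]
  have h1 : u = ∑ j : Fin (k + 1), Pi.single j (u j) := (Finset.univ_sum_single u).symm
  conv_rhs => rw [h1, map_sum]
  refine Finset.sum_congr rfl fun j _ => ?_
  rw [dif_pos j.2, TensorPredual.pairing_toMultilinear]
  rfl

/-- The closed unit ball of a dual space, with its weak-star topology. -/
abbrev WeakStarBall (𝕜 E : Type*) [RCLike 𝕜] [NormedAddCommGroup E] [NormedSpace 𝕜 E] : Type _ :=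
  ↥(WeakDual.toStrongDual ⁻¹' closedBall (0 : StrongDual 𝕜 E) 1 : Set (WeakDual 𝕜 E))

instance compactSpace_weakStarBall (𝕜 E : Type*) [RCLike 𝕜] [NormedAddCommGroup E]
    [NormedSpace 𝕜 E] : CompactSpace (WeakStarBall 𝕜 E) :=
  isCompact_iff_compactSpace.1 (WeakDual.isCompact_closedBall 0 1)

namespace WeakStarBall

variable {E : Type*} [NormedAddCommGroup E] [NormedSpace 𝕜 E]

/-- A point of the ball as a functional. -/
noncomputable def toDual (z : WeakStarBall 𝕜 E) : StrongDual 𝕜 E := WeakDual.toStrongDual z.1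

theorem norm_toDual_le (z : WeakStarBall 𝕜 E) : ‖z.toDual‖ ≤ 1 := mem_closedBall_zero_iff.1 z.2

theorem continuous_toDual_apply (f : E) : Continuous fun z : WeakStarBall 𝕜 E => z.toDual f :=
  (WeakDual.eval_continuous f).comp continuous_subtype_val

/-- A functional of norm at most `1` as a point of the ball. -/
noncomputable def ofDual (z : StrongDual 𝕜 E) (hz : ‖z‖ ≤ 1) : WeakStarBall 𝕜 E :=
  ⟨StrongDual.toWeakDual z, mem_closedBall_zero_iff.2 hz⟩

end WeakStarBall

/-- The product of the closed unit balls of `X''` and `Y''`, with the weak-star topologies. -/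
abbrev BidualBalls (𝕜 X Y : Type*) [RCLike 𝕜] [NormedAddCommGroup X] [NormedSpace 𝕜 X]
    [NormedAddCommGroup Y] [NormedSpace 𝕜 Y] : Type _ :=
  WeakStarBall 𝕜 (StrongDual 𝕜 X) × WeakStarBall 𝕜 (StrongDual 𝕜 Y)

/-- Averaging over a representing measure, which lives on the product of the bidual balls: the value
of a polynomial at a point of the closed convex hull of the evaluations at the unit balls is
bounded by a value of the extension. -/
theorem exists_re_polyPairing_le_re_sum_arens
    (hsep : TopologicalSpace.SeparableSpace (StrongDual 𝕜 X))
    (hap : HasApproximationProperty 𝕜 (StrongDual 𝕜 X))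
    {u : ∀ j : Fin (k + 1), TensorPredual 𝕜 X Y j}
    (hu : u ∈ closure (convexHull ℝ
      (range fun i : closedBall (0 : X) 1 × closedBall (0 : Y) 1 =>
        polyTensor 𝕜 k (i.1 : X) (i.2 : Y))))
    (Φ : (j : ℕ) → X [×j]→L[𝕜] StrongDual 𝕜 Y) :
    ∃ (z : StrongDual 𝕜 (StrongDual 𝕜 X)) (w : StrongDual 𝕜 (StrongDual 𝕜 Y)),
      ‖z‖ ≤ 1 ∧ ‖w‖ ≤ 1 ∧ RCLike.re (polyPairing k Φ u) ≤
        RCLike.re ((∑ j ∈ Finset.range (k + 1), arens (Φ j) (fun _ => z)) w) := by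
  borelize (BidualBalls 𝕜 X Y)
  obtain ⟨μ, hμ⟩ := exists_probabilityMeasure_of_mem_closure_convexHull (𝕜 := 𝕜)
    (K := BidualBalls 𝕜 X Y)
    (fun i : closedBall (0 : X) 1 × closedBall (0 : Y) 1 => polyTensor 𝕜 k (i.1 : X) (i.2 : Y))
    (fun i => (WeakStarBall.ofDual (inclusionInDoubleDual 𝕜 X i.1)
        ((norm_inclusionInDoubleDual_le _).trans (mem_closedBall_zero_iff.1 i.1.2)),
      WeakStarBall.ofDual (inclusionInDoubleDual 𝕜 Y i.2)
        ((norm_inclusionInDoubleDual_le _).trans (mem_closedBall_zero_iff.1 i.2.2)))) hu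
  have hZc : ∀ f : StrongDual 𝕜 X, Continuous fun p : BidualBalls 𝕜 X Y => p.1.toDual f := fun f =>
    (WeakStarBall.continuous_toDual_apply f).comp continuous_fst
  have hWc : ∀ v : StrongDual 𝕜 Y, Continuous fun p : BidualBalls 𝕜 X Y => p.2.toDual v := fun v =>
    (WeakStarBall.continuous_toDual_apply v).comp continuous_snd
  have hj : ∀ j : Fin (k + 1), TensorPredual.pairing (Φ j) (u j) =
      ∫ p : BidualBalls 𝕜 X Y, arens (Φ j) (fun _ => p.1.toDual) p.2.toDual
        ∂(μ : Measure (BidualBalls 𝕜 X Y)) := by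
    intro j
    refine TensorPredual.pairing_eq_integral_arens hsep hap (u j) (fun f => (hZc f).measurable)
      (fun v => (hWc v).measurable) (fun p => p.1.norm_toDual_le) (fun p => p.2.norm_toDual_le)
      (fun f v => ?_) (Φ j)
    refine hμ ((TensorPredual.pairing (prodSmul f v)).comp (ContinuousLinearMap.proj j))
      ⟨fun p => (∏ a, p.1.toDual (f a)) * p.2.toDual v,
        (continuous_finsetProd _ fun a _ => hZc (f a)).mul (hWc v)⟩ fun i => ?_
    change _ = TensorPredual.pairing (prodSmul f v) (TensorPredual.tmul (fun _ => (i.1 : X)) i.2)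
    rw [TensorPredual.pairing_tmul, prodSmul_apply]
    rfl
  have hint : ∀ j : ℕ, Integrable (fun p : BidualBalls 𝕜 X Y => arens (Φ j) (fun _ => p.1.toDual) p.2.toDual)
      (μ : Measure (BidualBalls 𝕜 X Y)) := fun j =>
    integrable_of_measurable_of_norm_le (measurable_arens hsep (Φ j)
      (fun _ f => (hZc f).measurable) (fun v => (hWc v).measurable)).stronglyMeasurable
      fun p => norm_arens_apply_le (Φ j) (fun _ => p.1.norm_toDual_le) p.2.norm_toDual_le
  have hval : polyPairing k Φ u = ∫ p : BidualBalls 𝕜 X Y, (∑ j ∈ Finset.range (k + 1),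
      arens (Φ j) (fun _ => p.1.toDual)) p.2.toDual ∂(μ : Measure (BidualBalls 𝕜 X Y)) := by
    rw [polyPairing_apply, Finset.sum_congr rfl fun j _ => hj j]
    simp only [sum_apply]
    rw [integral_finsetSum _ fun j _ => hint j, Finset.sum_range]
  have hint' : Integrable (fun p : BidualBalls 𝕜 X Y => (∑ j ∈ Finset.range (k + 1),
        arens (Φ j) (fun _ => p.1.toDual)) p.2.toDual) (μ : Measure (BidualBalls 𝕜 X Y)) := by
    simp only [sum_apply]
    exact integrable_finsetSum _ fun j _ => hint j
  obtain ⟨p, hp⟩ := exists_integral_le hint'.re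
  refine ⟨p.1.toDual, p.2.toDual, p.1.norm_toDual_le, p.2.norm_toDual_le, ?_⟩
  rw [hval, ← integral_re hint']
  exact hp

theorem ContPoly.norm_le_of_forall_re_le (Q : ContPoly 𝕜 k X (StrongDual 𝕜 Y)) {M : ℝ}
    (h : ∀ (x : X) (y : Y), ‖x‖ ≤ 1 → ‖y‖ ≤ 1 → RCLike.re (Q x y) ≤ M) : ‖Q‖ ≤ M := by
  have : Nonempty (closedBall (0 : X) 1) := ⟨⟨0, by simp⟩⟩
  refine ciSup_le fun x => le_of_forall_lt fun r hr => ?_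
  obtain ⟨y, hy, hry⟩ := ContinuousLinearMap.exists_lt_apply_of_lt_opNorm (Q x) hr
  obtain ⟨c, hc, hcy⟩ := RCLike.exists_norm_eq_mul_self (Q x y)
  have h1 := h x (c • y) (mem_closedBall_zero_iff.1 x.2)
    (by rw [norm_smul, hc, one_mul]; exact hy.le)
  rw [map_smul, smul_eq_mul, ← hcy, RCLike.ofReal_re] at h1
  exact hry.trans_le h1

end Density

theorem mainTheorem1 {𝕜 : Type*} [RCLike 𝕜]
    {X : Type*} [NormedAddCommGroup X] [NormedSpace 𝕜 X] [CompleteSpace X]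
    {Y : Type*} [NormedAddCommGroup Y] [NormedSpace 𝕜 Y] [CompleteSpace Y]
    (hsep : TopologicalSpace.SeparableSpace (StrongDual 𝕜 X))
    (hap : HasApproximationProperty 𝕜 (StrongDual 𝕜 X)) (k : ℕ) :
    Dense {P : ContPoly 𝕜 k X (StrongDual 𝕜 Y) | P.aronBerner.NormAttaining} := by
  intro P
  refine Metric.mem_closure_iff.2 fun ε hε => ?_
  set e : closedBall (0 : X) 1 × closedBall (0 : Y) 1 →
      ∀ j : Fin (k + 1), TensorPredual 𝕜 X Y j := fun i => polyTensor 𝕜 k (i.1 : X) (i.2 : Y)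
    with he
  set C := closure (convexHull ℝ (range e)) with hC
  have heC : ∀ i, e i ∈ C := fun i => subset_closure (subset_convexHull ℝ _ (mem_range_self i))
  have hCbdd : ∀ v ∈ C, ‖v‖ ≤ 1 := by
    intro v hv
    have h1 : C ⊆ closedBall 0 1 := by
      refine closure_minimal (convexHull_min ?_ (convex_closedBall 0 1)) isClosed_closedBall
      rintro _ ⟨i, rfl⟩
      exact mem_closedBall_zero_iff.2
        ((norm_polyTensor_le (mem_closedBall_zero_iff.1 i.1.2) _).trans
          (mem_closedBall_zero_iff.1 i.2.2))
    exact mem_closedBall_zero_iff.1 (h1 hv)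
  obtain ⟨g, hg, u, huC, hmax⟩ := exists_dual_norm_sub_le_forall_re_le (𝕜 := 𝕜) (C := C)
    ⟨_, heC (⟨0, by simp⟩, ⟨0, by simp⟩)⟩ isClosed_closure (convex_convexHull ℝ _).closure hCbdd
    (polyPairing k P.symmPart) (half_pos hε)
  obtain ⟨Ψ, hΨ⟩ := exists_polyPairing_eq g
  set Q : ContPoly 𝕜 k X (StrongDual 𝕜 Y) :=
    ⟨fun x => ∑ j ∈ Finset.range (k + 1), Ψ j (fun _ => x), Ψ, fun _ => rfl⟩ with hQ
  have hQg : ∀ x y, Q x y = g (polyTensor 𝕜 k x y) := by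
    intro x y
    rw [← hΨ, polyPairing_polyTensor]
  have hPf : ∀ x y, P x y = polyPairing k P.symmPart (polyTensor 𝕜 k x y) := by
    intro x y
    rw [polyPairing_polyTensor, ← P.symmPart_spec.2 x]
  refine ⟨Q, ?_, ?_⟩
  · have hQu : ‖Q‖ ≤ RCLike.re (g u) := by
      refine Q.norm_le_of_forall_re_le fun x y hx hy => ?_
      rw [hQg]
      exact hmax _ (heC (⟨x, mem_closedBall_zero_iff.2 hx⟩, ⟨y, mem_closedBall_zero_iff.2 hy⟩))
    -- On `C` the functional `g` depends only on the values of `Q`, so that the maps `Ψ` may be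
    -- replaced by the symmetric ones, which define the extension of `Q`.
    have hsymm : polyPairing k Q.symmPart u = g u := by
      have h1 : C ⊆ {v | polyPairing k Q.symmPart v = g v} := by
        refine closure_minimal (convexHull_min ?_ ?_)
          (isClosed_eq (ContinuousLinearMap.continuous _) g.continuous)
        · rintro _ ⟨i, rfl⟩
          simp only [mem_ofPred_eq, he]
          rw [polyPairing_polyTensor, ← hQg, ← Q.symmPart_spec.2]
        · intro v hv w hw a b _ _ _
          simp only [mem_ofPred_eq] at hv hw ⊢
          rw [map_add, map_add, ContinuousLinearMap.map_smul_of_tower,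
            ContinuousLinearMap.map_smul_of_tower, ContinuousLinearMap.map_smul_of_tower,
            ContinuousLinearMap.map_smul_of_tower, hv, hw]
      exact h1 huC
    obtain ⟨z, w, hz, hw, hzw⟩ := exists_re_polyPairing_le_re_sum_arens hsep hap huC Q.symmPart
    refine ⟨z, hz, le_antisymm (Q.aronBerner.norm_apply_le hz) (Q.norm_aronBerner_le.trans ?_)⟩
    rw [hsymm, ← Q.aronBerner_apply Q.symmPart_spec] at hzw
    calc ‖Q‖ ≤ RCLike.re (Q.aronBerner z w) := hQu.trans hzw
      _ ≤ ‖Q.aronBerner z w‖ := RCLike.re_le_norm _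
      _ ≤ ‖Q.aronBerner z‖ := (Q.aronBerner z).unit_le_opNorm w hw
  · refine lt_of_le_of_lt ?_ (half_lt_self hε)
    rw [dist_eq_norm]
    refine ContPoly.norm_le_of_forall_re_le _ fun x y hx hy => ?_
    have h1 : (P - Q : ContPoly 𝕜 k X (StrongDual 𝕜 Y)) x y =
        -(g - polyPairing k P.symmPart) (polyTensor 𝕜 k x y) := by
      change P x y - Q x y = _
      rw [hQg, hPf, sub_apply, neg_sub]
    rw [h1]
    refine (RCLike.re_le_norm _).trans ?_
    rw [norm_neg]
    exact (ContinuousLinearMap.le_of_opNorm_le _ hg _).trans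
      (mul_le_of_le_one_right (half_pos hε).le ((norm_polyTensor_le hx y).trans hy))
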